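/- Let $R$ be a $\mathbb{C}$-algebra (associative, unital, not necessarily commutative). Fix one of the following two conventions; the statement holds under each of them. (a) "Algebra" means arbitrary $\mathbb{C}$-algebra, "commutative $k$-algebra" means arbitrary commutative $k$-algebra, and flat covering families are indexed by finite sets. (b) "Algebra" means finitely generated $\mathbb{C}$-algebra, "commutative $k$-algebra" means finitely generated commutative $k$-algebra, and flat covering families are indexed by arbitrary sets. (Only $R$ is exempt from the finite generation in (b).) A family $\{E \to D_i\}_{i\in I}$ of maps of commutative rings, with $I$ allowed by the convention, is called flat if $E \to \prod_{i \in I} D_i$ is faithfully flat. Let $\mathsf{Azu}$ be the category whose objects are the algebras $A$ that are Azumaya over their center $Z(A)$, and whose morphisms $A \to B$ are the $\mathbb{C}$-algebra maps sending $Z(A)$ into $Z(B)$. A sieve on $A$ in $\mathsf{Azu}^{\mathrm{op}}$ is a collection $S$ of morphisms out of $A$ in $\mathsf{Azu}$ that is closed under composition with further morphisms. An algebra is of constant degree $n \geq 1$ if it has constant rank $n^2$ over its center. For a commutative $Z(A)$-algebra $D$, a central extension of $A \otimes_{Z(A)} D$ is a map $A\otimes_{Z(A)} D \to B$ with $B \in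 \mathsf{Azu}$ that maps $D$ isomorphically onto $Z(B)$. Given a sieve $S$ on $A$, call $Z(A) \to D$ centrally covered by $S$ if $A \otimes_{Z(A)} D$ is of some constant degree $n$ and the multiples $m$ of $n$ for which there is a central extension $A \otimes_{Z(A)} D \to B$, with $B$ of constant degree $m$ and with the composite $A \to B$ in $S$, form a covering sieve on $n$ for the maximal (atomic) topology on the poset of positive integers under divisibility, i.e. at least one such $m$ exists. The maximal flat topology on $\mathsf{Azu}^{\mathrm{op}}$ is the Grothendieck topology generated by the sieves $S$ for which some flat family $\{Z(A) \to D_i\}_{i \in I}$ consists of maps that are centrally covered by $S$. The flat topology on the opposite of the category of commutative $k$-algebras is the Grothendieck topology generated by the sieves that contain a flat family. Then: 1. The functor $A \mapsto \mathrm{Alg}(R,A)$ on $\mathsf{Azu}$, where $\mathrm{Alg}(R,A)$ is the set of $\mathbb{C}$-algebra maps $R \to A$, is a sheaf of sets for the maximal flat topology on $\mathsf{Azu}^{\mathrm{op}}$, and hence for every coarser Grothendieck topology. 2. For every $A \in \mathsf{Azu}$ with center $C$, the functor $D \mapsto \mathrm{Alg}(R, A \otimes_C D)$ on commutative $C$-algebras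 is a sheaf of sets for the flat topology on the opposite of the category of commutative $C$-algebras, and hence for every coarser Grothendieck topology. -/

import Mathlib

open CategoryTheory Opposite
open scoped TensorProduct

universe w v u

noncomputable section

/-- The two conventions on size under which the theory is developed:
* `all`: arbitrary algebras, flat covering families being finite;
* `affine`: finitely generated algebras, flat covering families being indexed by any set. -/
inductive SizeConvention
  | all
  | affine

namespace SizeConvention

/-- The algebras allowed by a convention. -/
def Admits (s : SizeConvention) (k : Type u) (A : Type v) [CommRing k] [Ring A] [Algebra k A] :
    Prop :=
  match s with
  | all => True
  | affine => Algebra.FiniteType k A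

/-- The index sets of covering families allowed by a convention. -/
def AdmitsIndex (s : SizeConvention) (ι : Type v) : Prop :=
  match s with
  | all => Finite ι
  | affine => True

end SizeConvention

/-- A family of ring maps `E → D i` (indexed by an allowed index set) such that `E → ∏ i, D i` is
faithfully flat. -/
def IsFlatFamily (s : SizeConvention) {E : Type u} [CommRing E] {ι : Type v} {D : ι → Type w}
    [∀ i, CommRing (D i)] (f : ∀ i, E →+* D i) : Prop :=
  s.AdmitsIndex ι ∧ (RingHom.pi f).FaithfullyFlat

/-- The smallest Grothendieck topology for which all the sieves of a given collection are covering.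
When the collection is itself a Grothendieck topology, this is that topology. -/
def topologyOf {C : Type u} [Category.{v} C] (cov : ∀ X : C, Set (Sieve X)) :
    GrothendieckTopology C :=
  sInf {J | ∀ X, cov X ⊆ J X}

theorem mem_topologyOf {C : Type u} [Category.{v} C] {cov : ∀ X : C, Set (Sieve X)} {X : C}
    {S : Sieve X} (hS : S ∈ cov X) : S ∈ topologyOf cov X :=
  (GrothendieckTopology.mem_sInf _ _).2 fun _ hJ => hJ X hS

theorem topologyOf_eq {C : Type u} [Category.{v} C] (J : GrothendieckTopology C) :
    topologyOf (fun X => {S : Sieve X | S ∈ J X}) = J :=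
  le_antisymm (sInf_le fun _ _ h => h) (le_sInf fun _ h X _ hS => h X hS)

/-! ### Commutative algebras and the flat topology -/

/-- The category of commutative `k`-algebras (finitely generated ones, for the convention
`affine`). -/
abbrev CommSite (s : SizeConvention) (k : Type u) [CommRing k] :=
  ObjectProperty.FullSubcategory (fun D : CommAlgCat.{v} k => s.Admits k D)

/-- The covering sieves of the flat topology: those containing a flat family `{E → D i}`. -/
def flatCovers (s : SizeConvention) (k : Type u) [CommRing k] (X : (CommSite.{v} s k)ᵒᵖ) :
    Set (Sieve X) :=
  {T | ∃ (ι : Type v) (D : ι → CommSite.{v} s k) (f : ∀ i, X.unop ⟶ D i),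
    (∀ i, T.arrows (f i).op) ∧ IsFlatFamily s fun i => ((f i).hom.hom : X.unop.obj →+* (D i).obj)}

/-- The flat topology on the opposite of the category of commutative `k`-algebras. -/
def flatTopology (s : SizeConvention) (k : Type u) [CommRing k] :
    GrothendieckTopology (CommSite.{v} s k)ᵒᵖ :=
  topologyOf (flatCovers s k)

/-! ### The category of Azumaya algebras -/

/-- An Azumaya algebra: a `ℂ`-algebra which is Azumaya over its center (and is finitely generated
over `ℂ`, for the convention `affine`). -/
structure Azu (s : SizeConvention) where
  carrier : Type u
  [ring : Ring carrier]
  [algebra : Algebra ℂ carrier]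
  isAzumaya : IsAzumaya (Subring.center carrier) carrier
  admits : s.Admits ℂ carrier

namespace Azu

variable {s : SizeConvention}

instance : CoeSort (Azu.{u} s) (Type u) := ⟨carrier⟩

attribute [instance] ring algebra

/-- The center of an Azumaya algebra. -/
abbrev Z (A : Azu.{u} s) : Subring A := Subring.center A

/-- A morphism of Azumaya algebras: a `ℂ`-algebra map which preserves centers. -/
@[ext]
structure Hom (A B : Azu.{u} s) where
  toAlgHom : A →ₐ[ℂ] B
  map_center : ∀ z ∈ A.Z, toAlgHom z ∈ B.Z

instance : Category (Azu.{u} s) where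
  Hom A B := Hom A B
  id A := ⟨AlgHom.id ℂ A, fun _ hz => hz⟩
  comp f g := ⟨g.toAlgHom.comp f.toAlgHom, fun z hz => g.map_center _ (f.map_center z hz)⟩

end Azu

/-- An algebra `E` is of constant degree `n` when it has constant rank `n ^ 2` over its center. -/
def HasConstDegree (E : Type u) [Ring E] (n : ℕ) : Prop :=
  ∀ p : PrimeSpectrum (Subring.center E), Module.rankAtStalk (R := Subring.center E) E p = n ^ 2

/-! ### The positive integers under division -/

/-- The poset category of positive integers, with a morphism `m ⟶ n` iff `n` divides `m`. -/
structure DivPos where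
  val : ℕ
  pos : 0 < val

namespace DivPos

instance : Preorder DivPos where
  le m n := n.val ∣ m.val
  le_refl _ := dvd_rfl
  le_trans _ _ _ h h' := h'.trans h

theorem rightOre : GrothendieckTopology.RightOreCondition DivPos := fun {_ Y Z} _ _ =>
  ⟨⟨Y.val * Z.val, Nat.mul_pos Y.pos Z.pos⟩, homOfLE (Dvd.intro _ rfl),
    homOfLE (Dvd.intro_left _ rfl), Subsingleton.elim _ _⟩

/-- The maximal (atomic) topology: all nonempty sieves are covering. -/
def maximalTopology : GrothendieckTopology DivPos := GrothendieckTopology.atomic rightOre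

end DivPos

/-! ### Extension of the flat topology to Azumaya algebras

A sieve on `A` in the opposite category of `Azu` is a collection of morphisms out of `A`. -/

namespace Azu

variable {s : SizeConvention} {A : Azu.{u} s}

/-- Let `C → D` be a commutative algebra over the center `C` of `A`. The number `m` is represented
on `C → D` by the sieve `S` when `S` contains (the restriction to `A` of) a central extension
`A ⊗ D → B`, i.e. one identifying `D` with the center of the Azumaya algebra `B`, where `B` has
constant degree `m`. -/
def IsRepresented (S : Sieve (op A)) (D : CommAlgCat.{u} A.Z) (m : ℕ) : Prop :=
  ∃ (B : Azu.{u} s) (φ : A ⊗[A.Z] D →ₐ[ℂ] B) (g : A ⟶ B),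
    HasConstDegree B m ∧
    Function.Injective (fun d : D => φ (1 ⊗ₜ d)) ∧
    Set.range (fun d : D => φ (1 ⊗ₜ d)) = (B.Z : Set B) ∧
    (∀ a : A, g.toAlgHom a = φ (a ⊗ₜ 1)) ∧
    S.arrows g.op

/-- `C → D` is centrally covered with respect to `K` and `S` when `A ⊗ D` is of some constant degree
`n` and the represented numbers form a `K`-covering sieve on `n`. -/
def IsCentrallyCovered (K : GrothendieckTopology DivPos) (S : Sieve (op A))
    (D : CommAlgCat.{u} A.Z) : Prop :=
  ∃ n : DivPos, HasConstDegree (A ⊗[A.Z] D) n.val ∧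
    Sieve.generate (X := n) (fun m _ => IsRepresented S D m.val) ∈ K n

/-- The covering sieves of the extension of the flat topology to `Azu` along `K`: those sieves `S`
on `A` for which the centrally covered maps out of the center `C` of `A` form a flat covering,
i.e. contain a flat family `{C → D i}`. -/
def flatExtensionCovers (s : SizeConvention) (K : GrothendieckTopology DivPos)
    (X : (Azu.{u} s)ᵒᵖ) : Set (Sieve X) :=
  {S | ∃ (ι : Type u) (D : ι → CommSite.{u} s X.unop.Z),
    (∀ i, IsCentrallyCovered (A := X.unop) K S (D i).obj) ∧
    IsFlatFamily s fun i => algebraMap X.unop.Z (D i).obj}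

/-- The maximal flat topology on the opposite of `Azu`: the extension of the flat topology along
the maximal topology on the positive integers. -/
def maximalFlatTopology (s : SizeConvention) : GrothendieckTopology (Azu.{u} s)ᵒᵖ :=
  topologyOf (flatExtensionCovers s DivPos.maximalTopology)

/-- The functor `A ↦ Alg(R, A)` on `Azu`. -/
def algFunctor (s : SizeConvention) (R : Type w) [Ring R] [Algebra ℂ R] :
    Azu.{u} s ⥤ Type (max w u) where
  obj A := R →ₐ[ℂ] A
  map f := ↾fun φ => f.toAlgHom.comp φ

/-- The base change `A ⊗ D → A ⊗ D'` along a map `D → D'` of algebras over the center of `A`, as a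
`ℂ`-algebra map. -/
def baseChangeMap (A : Azu.{u} s) {D D' : CommAlgCat.{u} A.Z} (f : D ⟶ D') :
    A ⊗[A.Z] D →ₐ[ℂ] A ⊗[A.Z] D' :=
  { (Algebra.TensorProduct.map (AlgHom.id A.Z A) f.hom : A ⊗[A.Z] D →+* A ⊗[A.Z] D') with
    commutes' := fun c => by simp [Algebra.TensorProduct.algebraMap_apply] }

@[simp]
theorem baseChangeMap_tmul (A : Azu.{u} s) {D D' : CommAlgCat.{u} A.Z} (f : D ⟶ D') (a : A)
    (d : D) : A.baseChangeMap f (a ⊗ₜ d) = a ⊗ₜ f.hom d := rfl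

theorem baseChangeMap_id (A : Azu.{u} s) (D : CommAlgCat.{u} A.Z) :
    A.baseChangeMap (𝟙 D) = AlgHom.id ℂ _ := by
  ext x
  induction x using TensorProduct.induction_on with
  | zero => simp
  | tmul a d => rfl
  | add x y hx hy => rw [map_add, map_add, hx, hy]

theorem baseChangeMap_comp (A : Azu.{u} s) {D D' D'' : CommAlgCat.{u} A.Z} (f : D ⟶ D')
    (g : D' ⟶ D'') : A.baseChangeMap (f ≫ g) = (A.baseChangeMap g).comp (A.baseChangeMap f) := by
  ext x
  induction x using TensorProduct.induction_on with
  | zero => simp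
  | tmul a d => rfl
  | add x y hx hy => rw [map_add, map_add, hx, hy]

/-- The functor `D ↦ Alg(R, A ⊗ D)` on commutative algebras `D` over the center of `A`. -/
def tensorAlgFunctor (R : Type w) [Ring R] [Algebra ℂ R] (A : Azu.{u} s) :
    CommSite.{u} s A.Z ⥤ Type (max w u) where
  obj D := R →ₐ[ℂ] A ⊗[A.Z] D.obj
  map f := ↾fun φ => (A.baseChangeMap f.hom).comp φ
  map_id D := by
    refine ConcreteCategory.hom_ext _ _ fun φ => ?_
    exact congrArg (fun h : A ⊗[A.Z] D.obj →ₐ[ℂ] A ⊗[A.Z] D.obj => h.comp φ)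
      (baseChangeMap_id A D.obj)
  map_comp {_ _ D''} f g := by
    refine ConcreteCategory.hom_ext _ _ fun φ => ?_
    exact congrArg (fun h : A ⊗[A.Z] _ →ₐ[ℂ] A ⊗[A.Z] D''.obj => h.comp φ)
      (baseChangeMap_comp A f.hom g.hom)

end Azu

end

noncomputable section

/-! ### Bimodules over Azumaya algebras -/

section Bimodules

/-! Both statements are faithfully flat descent. For the first, the difficulty is to pull a covering
of `A` back along a central map `A → F`, since the covering maps `g : A → B` are maps of
noncommutative algebras. The remedy is the centralizer `C` of `A` in `B`. It is Azumaya with the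
same center as `B`, and `B` is put together from `A` and `C` as a tensor product over `Z(A)` would
be (`IsCentralizer.exists_ringHom`). Hence `F ⊗ C` over `Z(A)` is Azumaya and receives maps from `F`
and from `B` that agree on `A` (`exists_inr`), so that `F → F ⊗ C` lies in the pulled back sieve.

If `B` is a central extension of `A ⊗ D`, then `C` has center `D`. It is projective over `D`, and a
separability element retracts it onto `D`; so flatness and joint faithfulness pass from the `D i` to
the centralizers. Descent of elements of a module (`IsFlatCover.exists_tmul_one`) uses flatness and
the element `1`, never commutativity. It applies to `F → F ⊗ C i`, and algebra maps out of `R` then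
descend value by value. For the second statement, `A` is finite projective over its center, and
coordinates reduce descent in `A ⊗ Y` to descent in `Y`.

The Azumaya condition is used through `HasInvariantSystem`: an expression `1 = ∑ (y i ⊗ 1) * t i`
with invariant `t i` in the enveloping algebra. Invariant elements carry any central `A`-ring into
the centralizer of `A`, so this single identity yields the decomposition of `B`. The condition is
equivalent to being Azumaya and passes to centralizers and products by explicit formulas. -/

/-- The enveloping algebra of a ring over its center. -/
abbrev Enveloping (E : Type*) [Ring E] : Type _ := E ⊗[Subring.center E] Eᵐᵒᵖ

namespace Enveloping

/-- Two commuting ring maps out of `E` and its opposite, agreeing on the center, induce a ring map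
out of the enveloping algebra. -/
def lift {E S : Type*} [Ring E] [Ring S] (α : E →+* S) (β : Eᵐᵒᵖ →+* S)
    (hc : ∀ u v, Commute (α u) (β v)) (hz : ∀ z : Subring.center E, α z = β (MulOpposite.op (z : E))) :
    Enveloping E →+* S :=
  let f : Enveloping E →+ S := TensorProduct.liftAddHom
    ((AddMonoidHom.mul.comp α.toAddMonoidHom).compl₂ β.toAddMonoidHom) (by
      intro z u v
      have h1 : z • u = u * (z : E) := (Subring.mem_center_iff.1 z.2 u).symm
      have h2 : z • v = MulOpposite.op (z : E) * v := by
        refine MulOpposite.unop_injective ?_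
        change (z : E) * v.unop = v.unop * (z : E)
        exact (Subring.mem_center_iff.1 z.2 _).symm
      rw [h1, h2]
      simp [hz, mul_assoc])
  have hf : ∀ u v, f (u ⊗ₜ v) = α u * β v := fun _ _ => rfl
  { f with
    map_one' := by
      change f (1 ⊗ₜ 1) = 1
      rw [hf, map_one, map_one, one_mul]
    map_mul' := by
      intro x y
      change f (x * y) = f x * f y
      induction x using TensorProduct.induction_on with
      | zero => simp
      | add x x' hx hx' => rw [add_mul, map_add, hx, hx', map_add, add_mul]
      | tmul u v =>
        induction y using TensorProduct.induction_on with
        | zero => simp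
        | add x x' hx hx' => rw [mul_add, map_add, hx, hx', map_add, mul_add]
        | tmul u' v' =>
          rw [Algebra.TensorProduct.tmul_mul_tmul, hf, hf, hf, map_mul, map_mul, mul_assoc,
            mul_assoc, ← mul_assoc (α u'), (hc u' v).eq, mul_assoc] }

/-- The element `t` commutes with `E` for the outer bimodule structure of the enveloping algebra. -/
def IsInvariant {E : Type*} [Ring E] (t : Enveloping E) : Prop :=
  ∀ x : E, (x ⊗ₜ 1 : Enveloping E) * t = (1 ⊗ₜ MulOpposite.op x : Enveloping E) * t

/-- A ring map is central when it maps the center into the center. -/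
def IsCentral {A B : Type*} [Ring A] [Ring B] (g : A →+* B) : Prop :=
  ∀ z ∈ Subring.center A, g z ∈ Subring.center B

section act

variable {A B : Type*} [Ring A] [Ring B] (g : A →+* B) (hg : IsCentral g)

/-- The action of the enveloping algebra of `A` on an `A`-ring `B`. -/
def act : Enveloping A →+* AddMonoid.End B :=
  lift ((Module.toAddMonoidEnd B B).comp g) ((Module.toAddMonoidEnd Bᵐᵒᵖ B).comp (RingHom.op g))
    (fun u v => AddMonoidHom.ext fun b => (mul_assoc (g u) b (g v.unop)).symm)
    (fun z => AddMonoidHom.ext fun b => (Subring.mem_center_iff.1 (hg z z.2) b).symm)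

@[simp]
theorem act_tmul (u : A) (v : Aᵐᵒᵖ) (b : B) : act g hg (u ⊗ₜ v) b = g u * (b * g v.unop) := rfl

theorem act_add (s t : Enveloping A) (b : B) :
    act g hg (s + t) b = act g hg s b + act g hg t b := by
  rw [map_add]; rfl

theorem act_mul (s t : Enveloping A) (b : B) :
    act g hg (s * t) b = act g hg s (act g hg t b) := by
  rw [map_mul]; rfl

theorem act_one_apply (b : B) : act g hg 1 b = b := by
  rw [map_one]; rfl

theorem act_sum {ι : Type*} (s : Finset ι) (t : ι → Enveloping A) (b : B) :
    act g hg (∑ i ∈ s, t i) b = ∑ i ∈ s, act g hg (t i) b := by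
  rw [map_sum]; exact AddMonoidHom.finsetSum_apply _ _ _

theorem act_tmul_one_mul (x : A) (t : Enveloping A) (b : B) :
    act g hg ((x ⊗ₜ 1) * t) b = g x * act g hg t b := by
  rw [act_mul, act_tmul]; simp

theorem act_one_tmul_mul (x : A) (t : Enveloping A) (b : B) :
    act g hg ((1 ⊗ₜ MulOpposite.op x) * t) b = act g hg t b * g x := by
  rw [act_mul, act_tmul]; simp

theorem act_mul_tmul_one (x : A) (t : Enveloping A) (b : B) :
    act g hg (t * (x ⊗ₜ 1)) b = act g hg t (g x * b) := by
  rw [act_mul, act_tmul]; simp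

theorem commute_act {t : Enveloping A} (ht : IsInvariant t) (x : A) (b : B) :
    g x * act g hg t b = act g hg t b * g x := by
  rw [← act_tmul_one_mul, ht x, act_one_tmul_mul]

/-- The action is linear on the right over the centralizer. -/
theorem act_mul_right (t : Enveloping A) (b : B) {n : B} (hn : ∀ a, g a * n = n * g a) :
    act g hg t (b * n) = act g hg t b * n := by
  induction t using TensorProduct.induction_on with
  | zero => simp
  | tmul u v => simp only [act_tmul, mul_assoc, hn]
  | add x y hx hy => simp only [act_add, add_mul, hx, hy]

/-- The action is linear on the left over the centralizer. -/
theorem act_mul_left (t : Enveloping A) (b : B) {n : B} (hn : ∀ a, g a * n = n * g a) :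
    act g hg t (n * b) = n * act g hg t b := by
  induction t using TensorProduct.induction_on with
  | zero => simp
  | tmul u v => simp only [act_tmul, ← mul_assoc, hn]
  | add x y hx hy => simp only [act_add, mul_add, hx, hy]

end act

theorem isCentral_id (A : Type*) [Ring A] : IsCentral (RingHom.id A) := fun _ h => h

/-- Naturality of the action; with `g` the identity it reduces computations on the image of `A` to
computations in `A`. -/
theorem act_map {A B B' : Type*} [Ring A] [Ring B] [Ring B'] (g : A →+* B) (hg : IsCentral g)
    (g' : A →+* B') (hg' : IsCentral g') (h : B →+* B') (hh : ∀ a, h (g a) = g' a)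
    (t : Enveloping A) (b : B) : act g' hg' t (h b) = h (act g hg t b) := by
  induction t using TensorProduct.induction_on with
  | zero => simp
  | tmul u v => simp only [act_tmul, map_mul, hh]
  | add x y hx hy => rw [act_add, act_add, hx, hy, map_add]

theorem mulLeftRight_eq_act {E : Type*} [Ring E] (t : Enveloping E) (x : E) :
    AlgHom.mulLeftRight (Subring.center E) E t x = act (RingHom.id E) (isCentral_id E) t x := by
  induction t using TensorProduct.induction_on with
  | zero => simp
  | tmul u v => simp [mul_assoc]
  | add x y hx hy => rw [map_add, LinearMap.add_apply, act_add, hx, hy]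

theorem IsInvariant.act_mem_center {E : Type*} [Ring E] {t : Enveloping E} (ht : IsInvariant t)
    (x : E) : act (RingHom.id E) (isCentral_id E) t x ∈ Subring.center E :=
  Subring.mem_center_iff.2 fun y => commute_act (RingHom.id E) _ ht y x

theorem IsInvariant.mul {E : Type*} [Ring E] {t : Enveloping E} (ht : IsInvariant t)
    (s : Enveloping E) : IsInvariant (t * s) := fun x => by
  rw [← mul_assoc, ht x, mul_assoc]

theorem IsInvariant.add {E : Type*} [Ring E] {t s : Enveloping E} (ht : IsInvariant t)
    (hs : IsInvariant s) : IsInvariant (t + s) := fun x => by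
  rw [mul_add, mul_add, ht x, hs x]

theorem smul_eq_tmul_one_mul {E : Type*} [Ring E] (z : Subring.center E) (t : Enveloping E) :
    z • t = ((z : E) ⊗ₜ 1 : Enveloping E) * t := by
  rw [← one_mul t, ← smul_mul_assoc, one_mul, Algebra.TensorProduct.one_def, TensorProduct.smul_tmul',
    Subring.smul_def, smul_eq_mul, mul_one]

theorem IsInvariant.smul {E : Type*} [Ring E] {t : Enveloping E} (ht : IsInvariant t)
    (z : Subring.center E) : IsInvariant (z • t) := fun x => by
  rw [mul_smul_comm, mul_smul_comm, ht x]

theorem isInvariant_zero {E : Type*} [Ring E] : IsInvariant (0 : Enveloping E) := fun x => by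
  rw [mul_zero, mul_zero]

end Enveloping

open Enveloping

/-- The enveloping algebra of `E` is generated by invariant elements as a left `E`-module. -/
def HasInvariantSystem (E : Type*) [Ring E] : Prop :=
  ∃ (n : ℕ) (y : Fin n → E) (t : Fin n → Enveloping E), (∀ i, IsInvariant (t i)) ∧
    ∑ i, (y i ⊗ₜ 1 : Enveloping E) * t i = 1

/-- A separability idempotent: an invariant element multiplying to one. -/
def IsSeparabilityElement {E : Type*} [Ring E] (e : Enveloping E) : Prop :=
  IsInvariant e ∧ act (RingHom.id E) (isCentral_id E) e 1 = 1

/-- Every element of an `A`-ring is a combination of elements of the centralizer of `A`. -/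
theorem sum_mul_act {A B : Type*} [Ring A] [Ring B] (g : A →+* B) (hg : IsCentral g) {n : ℕ}
    {y : Fin n → A} {t : Fin n → Enveloping A}
    (h : ∑ i, (y i ⊗ₜ 1 : Enveloping A) * t i = 1) (b : B) :
    ∑ i, g (y i) * act g hg (t i) b = b := by
  have := congrArg (fun s => act g hg s b) h
  simp only [act_sum, act_tmul_one_mul, act_one_apply] at this
  exact this

theorem IsSeparabilityElement.act_one {A B : Type*} [Ring A] [Ring B] (g : A →+* B)
    (hg : IsCentral g) {e : Enveloping A} (he : IsSeparabilityElement e) : act g hg e 1 = 1 := by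
  rw [← map_one g, act_map (RingHom.id A) (isCentral_id A) g hg g (fun _ => rfl), he.2]

theorem IsSeparabilityElement.act_of_commute {A B : Type*} [Ring A] [Ring B] (g : A →+* B)
    (hg : IsCentral g) {e : Enveloping A} (he : IsSeparabilityElement e) {n : B}
    (hn : ∀ a, g a * n = n * g a) : act g hg e n = n := by
  conv_lhs => rw [← one_mul n]
  rw [act_mul_right g hg e 1 hn, he.act_one, one_mul]

/-- Take a dual basis of `E` over its center. Each coordinate form, viewed as an endomorphism of
`E`, is the action of a unique `t i`. Its values are central, which makes `t i` invariant, and the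
dual basis identity becomes the required expression of `1`. -/
theorem hasInvariantSystem_of_isAzumaya (E : Type*) [Ring E]
    (h : IsAzumaya (Subring.center E) E) : HasInvariantSystem E := by
  obtain ⟨n, f, g, -, -, hfg⟩ :=
    Module.Finite.exists_comp_eq_id_of_projective (Subring.center E) E
  have key : ∀ i, ∃ t : Enveloping E, ∀ x,
      act (RingHom.id E) (isCentral_id E) t x = (g x i : E) := fun i => by
    obtain ⟨t, ht⟩ := h.bij.2 ((Algebra.linearMap (Subring.center E) E).comp
      ((LinearMap.proj i).comp g))
    refine ⟨t, fun x => ?_⟩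
    rw [← mulLeftRight_eq_act, ht]
    rfl
  choose t ht using key
  refine ⟨n, fun i => f (Pi.single i 1), t, fun i x => ?_, ?_⟩
  · refine h.bij.1 (LinearMap.ext fun y => ?_)
    rw [mulLeftRight_eq_act, mulLeftRight_eq_act, act_tmul_one_mul, act_one_tmul_mul, ht]
    exact Subring.mem_center_iff.1 (g y i).2 x
  · refine h.bij.1 (LinearMap.ext fun x => ?_)
    rw [mulLeftRight_eq_act, mulLeftRight_eq_act]
    simp only [act_sum, act_tmul_one_mul, act_one_apply, ht]
    have := LinearMap.congr_fun hfg x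
    rw [LinearMap.comp_apply, LinearMap.pi_apply_eq_sum_univ f] at this
    rw [LinearMap.id_apply] at this
    conv_rhs => rw [← this]
    refine Finset.sum_congr rfl fun i _ => ?_
    rw [show (Pi.single i 1 : Fin n → Subring.center E) = fun j => if i = j then 1 else 0 by
      ext j; simp [Pi.single_apply, eq_comm]]
    exact Subring.mem_center_iff.1 (g x i).2 _

/-- The values at `1` of invariant elements form an ideal `I` of the center. Since `t i` acts on `x`
as `t i * (x ⊗ 1)` acts on `1`, the invariant system gives `I • E = E`. By Nakayama some `r`
congruent to `1` modulo `I` kills `E`, in particular `1`; so `r = 0` and `1 ∈ I`. -/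
theorem exists_isSeparabilityElement {E : Type*} [Ring E]
    (h : HasInvariantSystem E) : ∃ e : Enveloping E, IsSeparabilityElement e := by
  obtain ⟨n, y, t, ht, hyt⟩ := h
  let I : Ideal (Subring.center E) :=
    { carrier := {c | ∃ e : Enveloping E, IsInvariant e ∧
        act (RingHom.id E) (isCentral_id E) e 1 = (c : E)}
      zero_mem' := ⟨0, isInvariant_zero, by simp⟩
      add_mem' := by
        rintro a b ⟨e, he, h⟩ ⟨e', he', h'⟩
        exact ⟨e + e', he.add he', by rw [act_add, h, h']; rfl⟩
      smul_mem' := by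
        rintro c a ⟨e, he, h⟩
        exact ⟨c • e, he.smul c, by rw [smul_eq_tmul_one_mul, act_tmul_one_mul, h]; rfl⟩ }
  have hE : ∀ x : E, ∑ i, y i * act (RingHom.id E) (isCentral_id E) (t i) x = x :=
    sum_mul_act (RingHom.id E) _ hyt
  have hfg : (⊤ : Submodule (Subring.center E) E).FG := by
    classical
    refine ⟨Finset.univ.image y, top_le_iff.1 fun x _ => ?_⟩
    rw [← hE x]
    refine Submodule.sum_mem _ fun i _ => ?_
    rw [Subring.mem_center_iff.1 ((ht i).act_mem_center x)]
    exact Submodule.smul_mem _ (⟨_, (ht i).act_mem_center x⟩ : Subring.center E)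
      (Submodule.subset_span (by simp))
  obtain ⟨r, hr, hr0⟩ := Submodule.exists_sub_one_mem_and_smul_eq_zero_of_fg_of_le_smul I ⊤ hfg
    (fun x _ => by
      rw [← hE x]
      refine Submodule.sum_mem _ fun i _ => ?_
      rw [Subring.mem_center_iff.1 ((ht i).act_mem_center x)]
      refine Submodule.smul_mem_smul (r := (⟨_, (ht i).act_mem_center x⟩ : Subring.center E))
        ⟨t i * (x ⊗ₜ 1), (ht i).mul _, ?_⟩ trivial
      rw [act_mul_tmul_one, mul_one]; rfl)
  have h0 : r = 0 := Subtype.ext (by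
    have := hr0 1 trivial
    rwa [Subring.smul_def, smul_eq_mul, mul_one] at this)
  rw [h0, zero_sub, neg_mem_iff] at hr
  exact hr

/-- The actions of the `t i` are forms with values in the center and make the `y i` a dual basis. An
endomorphism `φ` is the action of `∑ (φ (y i) ⊗ 1) * t i`, and an element acting as zero is killed
by expanding `1`. -/
theorem isAzumaya_of_hasInvariantSystem {E : Type*} [Ring E] (h : HasInvariantSystem E) :
    IsAzumaya (Subring.center E) E := by
  obtain ⟨n, y, t, ht, hyt⟩ := h
  have hE : ∀ x : E, ∑ i, y i * act (RingHom.id E) (isCentral_id E) (t i) x = x :=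
    sum_mul_act (RingHom.id E) _ hyt
  have hcomm : ∀ i x z, z * act (RingHom.id E) (isCentral_id E) (t i) x =
      act (RingHom.id E) (isCentral_id E) (t i) x * z :=
    fun i x z => Subring.mem_center_iff.1 ((ht i).act_mem_center x) z
  let f : (Fin n → Subring.center E) →ₗ[Subring.center E] E :=
    Fintype.linearCombination _ y
  let g : E →ₗ[Subring.center E] (Fin n → Subring.center E) :=
    LinearMap.pi fun i =>
      { toFun := fun x => ⟨_, (ht i).act_mem_center x⟩
        map_add' := fun x y => Subtype.ext (map_add _ x y)
        map_smul' := fun c x => Subtype.ext (by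
          exact act_mul_left (RingHom.id E) _ (t i) x
            (fun a => Subring.mem_center_iff.1 c.2 a)) }
  have hfg : f.comp g = LinearMap.id := LinearMap.ext fun x => by
    change f (g x) = x
    rw [Fintype.linearCombination_apply]
    conv_rhs => rw [← hE x]
    exact Finset.sum_congr rfl fun i _ => (hcomm i x (y i)).symm
  have : Module.Projective (Subring.center E) E := Module.Projective.of_split g f hfg
  have : Module.Finite (Subring.center E) E :=
    Module.Finite.of_surjective f fun x => ⟨g x, LinearMap.congr_fun hfg x⟩
  have : FaithfulSMul (Subring.center E) E := ⟨fun {a b} hab => Subtype.ext (by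
    have := hab 1
    rwa [Subring.smul_def, Subring.smul_def, smul_eq_mul, smul_eq_mul, mul_one, mul_one] at this)⟩
  refine { bij := ⟨?_, ?_⟩ }
  · rw [injective_iff_map_eq_zero]
    intro s hs
    have hs' : ∀ x, act (RingHom.id E) (isCentral_id E) s x = 0 := fun x => by
      rw [← mulLeftRight_eq_act, hs]; rfl
    -- Invariance of `t i` moves the opposite factor of `s` to the left tensor factor, where it
    -- multiplies `y i` from the right.
    have key : ∀ (s : Enveloping E) (i : Fin n), s * ((y i ⊗ₜ 1) * t i) =
        (act (RingHom.id E) (isCentral_id E) s (y i) ⊗ₜ 1) * t i := by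
      intro s i
      induction s using TensorProduct.induction_on with
      | zero => simp
      | add a b ha hb =>
        simp only [add_mul, ha, hb, act_add, TensorProduct.add_tmul]
      | tmul u v =>
        rw [show (u ⊗ₜ v : Enveloping E) = (u ⊗ₜ 1) * (1 ⊗ₜ v) by simp, mul_assoc,
          ← mul_assoc (1 ⊗ₜ v) (y i ⊗ₜ 1),
          show (1 ⊗ₜ v : Enveloping E) * (y i ⊗ₜ 1) = (y i ⊗ₜ 1) * (1 ⊗ₜ v) by simp, mul_assoc,
          show (1 ⊗ₜ v : Enveloping E) = 1 ⊗ₜ MulOpposite.op v.unop from rfl, ← ht i]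
        simp only [← mul_assoc, Algebra.TensorProduct.tmul_mul_tmul, one_mul, mul_one, act_tmul,
          MulOpposite.op_unop, RingHom.id_apply]
    rw [← mul_one s, ← hyt, Finset.mul_sum]
    refine Finset.sum_eq_zero fun i _ => ?_
    rw [key, hs', TensorProduct.zero_tmul, zero_mul]
  · intro φ
    refine ⟨∑ i, (φ (y i) ⊗ₜ 1) * t i, LinearMap.ext fun x => ?_⟩
    rw [mulLeftRight_eq_act]
    simp only [act_sum, act_tmul_one_mul]
    conv_rhs => rw [← hE x]
    rw [map_sum]
    refine Finset.sum_congr rfl fun i _ => ?_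
    rw [hcomm, RingHom.id_apply, hcomm]
    exact (φ.map_smul (⟨_, (ht i).act_mem_center x⟩ : Subring.center E) (y i)).symm ▸ rfl

end Bimodules

/-! ### Centralizers of Azumaya algebras in Azumaya algebras -/

section Centralizers

open Enveloping

/-- The ring map `j` identifies its source with the centralizer of the image of `g`. -/
structure IsCentralizer {A B L : Type*} [Ring A] [Ring B] [Ring L] (g : A →+* B) (j : L →+* B) :
    Prop where
  injective : Function.Injective j
  commute : ∀ a l, g a * j l = j l * g a
  exists_eq : ∀ b, (∀ a, g a * b = b * g a) → ∃ l, j l = b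

namespace IsCentralizer

variable {A B L : Type*} [Ring A] [Ring B] [Ring L] {g : A →+* B} {j : L →+* B}

/-- The ring `B` is generated by `A` and its centralizer, and a central element of the centralizer
commutes with both. -/
theorem isCentral (h : IsCentralizer g j) (hg : IsCentral g) (hA : HasInvariantSystem A) :
    IsCentral j := by
  obtain ⟨n, y, t, ht, hyt⟩ := hA
  intro z hz
  refine Subring.mem_center_iff.2 fun b => ?_
  rw [← sum_mul_act g hg hyt b, Finset.sum_mul, Finset.mul_sum]
  refine Finset.sum_congr rfl fun i _ => ?_
  obtain ⟨l, hl⟩ := h.exists_eq _ fun a => commute_act g hg (ht i) a b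
  rw [← hl, mul_assoc, ← map_mul, Subring.mem_center_iff.1 hz l, map_mul, ← mul_assoc, h.commute,
    mul_assoc]

theorem mem_center (h : IsCentralizer g j) {z : L} (hz : j z ∈ Subring.center B) :
    z ∈ Subring.center L :=
  Subring.mem_center_iff.2 fun l => h.injective (by
    rw [map_mul, map_mul, Subring.mem_center_iff.1 hz])

theorem exists_center (h : IsCentralizer g j) {z : B} (hz : z ∈ Subring.center B) :
    ∃ l ∈ Subring.center L, j l = z := by
  obtain ⟨l, rfl⟩ := h.exists_eq z fun a => Subring.mem_center_iff.1 hz _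
  exact ⟨l, h.mem_center hz, rfl⟩

/-- The element of the centralizer obtained by acting with an invariant element. -/
def proj (h : IsCentralizer g j) (hg : IsCentral g) {t : Enveloping A} (ht : IsInvariant t) :
    B →+ L where
  toFun b := (h.exists_eq _ fun a => commute_act g hg ht a b).choose
  map_zero' := h.injective (by
    rw [(h.exists_eq _ fun a => commute_act g hg ht a _).choose_spec, map_zero, map_zero])
  map_add' x y := h.injective <| by
    refine (h.exists_eq _ fun a => commute_act g hg ht a (x + y)).choose_spec.trans ?_
    rw [map_add j, (h.exists_eq _ fun a => commute_act g hg ht a x).choose_spec,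
      (h.exists_eq _ fun a => commute_act g hg ht a y).choose_spec, map_add]

theorem map_proj (h : IsCentralizer g j) (hg : IsCentral g) {t : Enveloping A}
    (ht : IsInvariant t) (b : B) : j (h.proj hg ht b) = act g hg t b :=
  (h.exists_eq _ fun a => commute_act g hg ht a b).choose_spec

theorem proj_mul_left (h : IsCentralizer g j) (hg : IsCentral g) {t : Enveloping A}
    (ht : IsInvariant t) (l : L) (b : B) : h.proj hg ht (j l * b) = l * h.proj hg ht b :=
  h.injective (by
    rw [map_mul j, map_proj, map_proj, act_mul_left g hg t b fun a => h.commute a l])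

theorem proj_mul_right (h : IsCentralizer g j) (hg : IsCentral g) {t : Enveloping A}
    (ht : IsInvariant t) (l : L) (b : B) : h.proj hg ht (b * j l) = h.proj hg ht b * l :=
  h.injective (by
    rw [map_mul j, map_proj, map_proj, act_mul_right g hg t b fun a => h.commute a l])

theorem proj_one (h : IsCentralizer g j) (hg : IsCentral g) {e : Enveloping A}
    (he : IsSeparabilityElement e) : h.proj hg he.1 1 = 1 :=
  h.injective (by rw [map_proj, he.act_one, map_one])

/-- The projection of enveloping algebras induced by a projection onto the centralizer. -/
def projEnveloping (h : IsCentralizer g j) (hg : IsCentral g) {e : Enveloping A}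
    (he : IsInvariant e) : Enveloping B →+ Enveloping L :=
  TensorProduct.liftAddHom
    ((AddMonoidHom.mul.comp ((Algebra.TensorProduct.includeLeft :
      L →ₐ[Subring.center L] Enveloping L).toRingHom.toAddMonoidHom.comp (h.proj hg he))).compl₂
      ((Algebra.TensorProduct.includeRight :
      Lᵐᵒᵖ →ₐ[Subring.center L] Enveloping L).toRingHom.toAddMonoidHom.comp
        (AddMonoidHom.mulOp (h.proj hg he)))) (by
    intro z u v
    obtain ⟨l, hl, hlz⟩ := h.exists_center z.2
    have h1 : h.proj hg he (z • u) = l * h.proj hg he u := by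
      rw [Subring.smul_def, smul_eq_mul, ← hlz, h.proj_mul_left]
    have h2 : h.proj hg he (z • v).unop = l * h.proj hg he v.unop := by
      rw [MulOpposite.unop_smul, Subring.smul_def, smul_eq_mul, ← hlz, h.proj_mul_left]
    change (h.proj hg he (z • u) ⊗ₜ 1 : Enveloping L) *
      (1 ⊗ₜ MulOpposite.op (h.proj hg he v.unop)) = (h.proj hg he u ⊗ₜ 1 : Enveloping L) *
      (1 ⊗ₜ MulOpposite.op (h.proj hg he (z • v).unop))
    rw [h1, h2]
    simp only [Algebra.TensorProduct.tmul_mul_tmul, one_mul, mul_one]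
    exact TensorProduct.smul_tmul (⟨l, hl⟩ : Subring.center L) (h.proj hg he u)
      (MulOpposite.op (h.proj hg he v.unop)))

theorem projEnveloping_tmul (h : IsCentralizer g j) (hg : IsCentral g) {e : Enveloping A}
    (he : IsInvariant e) (u : B) (v : Bᵐᵒᵖ) : h.projEnveloping hg he (u ⊗ₜ v) =
      (h.proj hg he u ⊗ₜ MulOpposite.op (h.proj hg he v.unop)) := by
  change (h.proj hg he u ⊗ₜ 1 : Enveloping L) *
      (1 ⊗ₜ MulOpposite.op (h.proj hg he v.unop)) = _
  simp

theorem projEnveloping_tmul_one_mul (h : IsCentralizer g j) (hg : IsCentral g) {e : Enveloping A}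
    (he : IsInvariant e) (l : L) (t : Enveloping B) :
    h.projEnveloping hg he ((j l ⊗ₜ 1) * t) = (l ⊗ₜ 1) * h.projEnveloping hg he t := by
  induction t using TensorProduct.induction_on with
  | zero => simp
  | tmul u v => simp [projEnveloping_tmul, proj_mul_left]
  | add x y hx hy => rw [mul_add, map_add, hx, hy, map_add, mul_add]

theorem projEnveloping_one_tmul_mul (h : IsCentralizer g j) (hg : IsCentral g) {e : Enveloping A}
    (he : IsInvariant e) (l : L) (t : Enveloping B) :
    h.projEnveloping hg he ((1 ⊗ₜ MulOpposite.op (j l)) * t) =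
      (1 ⊗ₜ MulOpposite.op l) * h.projEnveloping hg he t := by
  induction t using TensorProduct.induction_on with
  | zero => simp
  | tmul u v => simp [projEnveloping_tmul, proj_mul_right]
  | add x y hx hy => rw [mul_add, map_add, hx, hy, map_add, mul_add]

/-- The centralizer of an Azumaya algebra in an Azumaya algebra is Azumaya. -/
theorem hasInvariantSystem (h : IsCentralizer g j) (hg : IsCentral g)
    (hA : HasInvariantSystem A) (hB : HasInvariantSystem B) : HasInvariantSystem L := by
  obtain ⟨e, he⟩ := exists_isSeparabilityElement hA
  obtain ⟨m, z, s, hs, hzs⟩ := hA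
  obtain ⟨n, y, t, ht, hyt⟩ := hB
  -- Multiplying by `g a ⊗ 1` destroys invariance under `B`, but not under the centralizer, which
  -- commutes with `g a`.
  have key : ∀ (x : L) (a : A) (i : Fin n), (j x ⊗ₜ 1 : Enveloping B) * ((g a ⊗ₜ 1) * t i) =
      (1 ⊗ₜ MulOpposite.op (j x)) * ((g a ⊗ₜ 1) * t i) := by
    intro x a i
    have h1 : (j x ⊗ₜ 1 : Enveloping B) * (g a ⊗ₜ 1) = (g a ⊗ₜ 1) * (j x ⊗ₜ 1) := by
      simp [h.commute]
    have h2 : (1 ⊗ₜ MulOpposite.op (j x) : Enveloping B) * (g a ⊗ₜ 1) =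
        (g a ⊗ₜ 1) * (1 ⊗ₜ MulOpposite.op (j x)) := by simp
    rw [← mul_assoc, h1, mul_assoc, ht i, ← mul_assoc, ← h2, mul_assoc]
  -- Expand each `y i` over `A` with coefficients in the centralizer, then apply `projEnveloping`:
  -- it fixes `1`, as `e` is a separability element, and lets the coefficients out.
  have hsum : ∑ k : Fin n × Fin m, (h.proj hg (hs k.2) (y k.1) ⊗ₜ 1 : Enveloping L) *
      h.projEnveloping hg he.1 ((g (z k.2) ⊗ₜ 1) * t k.1) = 1 := by
    rw [Fintype.sum_prod_type]
    have h1 : h.projEnveloping hg he.1 1 = 1 := by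
      rw [Algebra.TensorProduct.one_def, projEnveloping_tmul, MulOpposite.unop_one,
        h.proj_one hg he]; rfl
    rw [← h1, ← hyt, map_sum]
    refine Finset.sum_congr rfl fun i _ => ?_
    conv_rhs => rw [← sum_mul_act g hg hzs (y i)]
    rw [TensorProduct.sum_tmul, Finset.sum_mul, map_sum]
    refine Finset.sum_congr rfl fun k _ => ?_
    rw [← h.projEnveloping_tmul_one_mul, map_proj, ← mul_assoc, commute_act g hg (hs k)]
    simp
  refine ⟨n * m, fun k => h.proj hg (hs (finProdFinEquiv.symm k).2) (y (finProdFinEquiv.symm k).1),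
    fun k => h.projEnveloping hg he.1 ((g (z (finProdFinEquiv.symm k).2) ⊗ₜ 1) *
      t (finProdFinEquiv.symm k).1), fun k x => ?_, ?_⟩
  · rw [← h.projEnveloping_tmul_one_mul, ← h.projEnveloping_one_tmul_mul, key]
  · rw [← hsum]
    exact Equiv.sum_comp finProdFinEquiv.symm fun k : Fin n × Fin m =>
      (h.proj hg (hs k.2) (y k.1) ⊗ₜ 1 : Enveloping L) *
      h.projEnveloping hg he.1 ((g (z k.2) ⊗ₜ 1) * t k.1)

end IsCentralizer

end Centralizers

/-! ### Rings generated by two commuting Azumaya algebras -/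

section Products

open Enveloping

/-- The map of enveloping algebras induced by a central map. -/
def Enveloping.map {A B : Type*} [Ring A] [Ring B] (g : A →+* B) (hg : IsCentral g) :
    Enveloping A →+* Enveloping B :=
  lift ((Algebra.TensorProduct.includeLeft : B →ₐ[Subring.center B] Enveloping B).toRingHom.comp g)
    ((Algebra.TensorProduct.includeRight :
      Bᵐᵒᵖ →ₐ[Subring.center B] Enveloping B).toRingHom.comp (RingHom.op g))
    (fun u v => by
      change (g u ⊗ₜ 1 : Enveloping B) * (1 ⊗ₜ MulOpposite.op (g v.unop)) =
        (1 ⊗ₜ MulOpposite.op (g v.unop)) * (g u ⊗ₜ 1)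
      simp)
    (fun z => by
      have := TensorProduct.smul_tmul (R := Subring.center B) (R' := Subring.center B)
        (⟨g z, hg z z.2⟩ : Subring.center B) (1 : B) (1 : Bᵐᵒᵖ)
      rw [Subring.smul_def, smul_eq_mul, mul_one] at this
      refine this.trans ?_
      congr 1
      exact MulOpposite.unop_injective (mul_one (g z)))

theorem Enveloping.map_tmul {A B : Type*} [Ring A] [Ring B] (g : A →+* B) (hg : IsCentral g)
    (u : A) (v : Aᵐᵒᵖ) : map g hg (u ⊗ₜ v) = g u ⊗ₜ MulOpposite.op (g v.unop) := by
  change (g u ⊗ₜ 1 : Enveloping B) * (1 ⊗ₜ MulOpposite.op (g v.unop)) = _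
  simp

/-- The ring `E` is generated by the images of two commuting central maps. -/
structure IsProduct {F L E : Type*} [Ring F] [Ring L] [Ring E] (i : F →+* E) (j : L →+* E) :
    Prop where
  left : IsCentral i
  right : IsCentral j
  commute : ∀ f l, i f * j l = j l * i f
  mem_closure : ∀ x, x ∈ AddSubmonoid.closure {x | ∃ f l, x = i f * j l}

namespace IsProduct

variable {F L E : Type*} [Ring F] [Ring L] [Ring E] {i : F →+* E} {j : L →+* E}

theorem commute_map_left (h : IsProduct i j) (l : L) (t : Enveloping F) :
    (j l ⊗ₜ 1) * map i h.left t = map i h.left t * (j l ⊗ₜ 1) ∧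
    (1 ⊗ₜ MulOpposite.op (j l)) * map i h.left t =
      map i h.left t * (1 ⊗ₜ MulOpposite.op (j l)) := by
  induction t using TensorProduct.induction_on with
  | zero => simp
  | tmul u v =>
    simp only [map_tmul, Algebra.TensorProduct.tmul_mul_tmul, one_mul, mul_one, h.commute,
      ← MulOpposite.op_mul, and_self]
  | add x y hx hy => simp only [map_add, mul_add, add_mul, hx.1, hx.2, hy.1, hy.2, and_self]

theorem isInvariant_mul (h : IsProduct i j) {t : Enveloping F} {s : Enveloping L}
    (ht : IsInvariant t) (hs : IsInvariant s) :
    IsInvariant (map i h.left t * map j h.right s) := by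
  intro x
  induction h.mem_closure x using AddSubmonoid.closure_induction with
  | zero => simp
  | add x y _ _ hx hy =>
    rw [TensorProduct.add_tmul, add_mul, hx, hy, MulOpposite.op_add, TensorProduct.tmul_add,
      add_mul]
  | mem x hx =>
    obtain ⟨f, l, rfl⟩ := hx
    have hf := congrArg (map i h.left) (ht f)
    have hl := congrArg (map j h.right) (hs l)
    rw [map_mul, map_mul, map_tmul, map_tmul, MulOpposite.unop_op, MulOpposite.unop_one,
      map_one, MulOpposite.op_one] at hf hl
    have h1 : ((i f * j l) ⊗ₜ 1 : Enveloping E) = (i f ⊗ₜ 1) * (j l ⊗ₜ 1) := by simp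
    have h2 : (1 ⊗ₜ MulOpposite.op (i f * j l) : Enveloping E) =
        (1 ⊗ₜ MulOpposite.op (j l)) * (1 ⊗ₜ MulOpposite.op (i f)) := by simp
    rw [h1, h2, mul_assoc, ← mul_assoc (j l ⊗ₜ 1), (h.commute_map_left l t).1, ← mul_assoc,
      ← mul_assoc, hf, mul_assoc _ _ (map j h.right s), hl, ← mul_assoc, mul_assoc _ (map i h.left t),
      ← (h.commute_map_left l t).2, ← mul_assoc, ← mul_assoc]
    congr 2
    simp [← MulOpposite.op_mul, h.commute]

/-- Multiply the two expressions of `1`; the factors from `F` and `L` can be regrouped because their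
images commute. -/
theorem hasInvariantSystem (h : IsProduct i j) (hF : HasInvariantSystem F)
    (hL : HasInvariantSystem L) : HasInvariantSystem E := by
  obtain ⟨m, z, s, hs, hzs⟩ := hF
  obtain ⟨n, y, t, ht, hyt⟩ := hL
  refine ⟨m * n, fun k => i (z (finProdFinEquiv.symm k).1) * j (y (finProdFinEquiv.symm k).2),
    fun k => map i h.left (s (finProdFinEquiv.symm k).1) *
      map j h.right (t (finProdFinEquiv.symm k).2),
    fun k => h.isInvariant_mul (hs _) (ht _), ?_⟩
  refine (Equiv.sum_comp finProdFinEquiv.symm fun k : Fin m × Fin n =>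
    ((i (z k.1) * j (y k.2)) ⊗ₜ 1 : Enveloping E) *
      (map i h.left (s k.1) * map j h.right (t k.2))).trans ?_
  have h1 : ∀ k : Fin m × Fin n, ((i (z k.1) * j (y k.2)) ⊗ₜ 1 : Enveloping E) *
      (map i h.left (s k.1) * map j h.right (t k.2)) =
      map i h.left ((z k.1 ⊗ₜ 1) * s k.1) * map j h.right ((y k.2 ⊗ₜ 1) * t k.2) := by
    intro k
    rw [map_mul, map_mul, map_tmul, map_tmul, MulOpposite.unop_one, map_one,
      MulOpposite.op_one, MulOpposite.unop_one, map_one, MulOpposite.op_one, mul_assoc _ _ (_ * _),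
      ← mul_assoc (map i h.left (s k.1)), ← (h.commute_map_left _ _).1]
    simp only [← mul_assoc]
    congr 2
    simp
  rw [Finset.sum_congr rfl fun k _ => h1 k, Fintype.sum_prod_type]
  refine (Fintype.sum_mul_sum (fun a => map i h.left ((z a ⊗ₜ 1) * s a))
    (fun b => map j h.right ((y b ⊗ₜ 1) * t b))).symm.trans ?_
  rw [← map_sum, ← map_sum, hzs, hyt, map_one, map_one, mul_one]

/-- The center of a product of Azumaya algebras is generated by the two centers. -/
theorem mem_closure_of_mem_center (h : IsProduct i j) (hF : HasInvariantSystem F)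
    (hL : HasInvariantSystem L) {x : E} (hx : x ∈ Subring.center E) :
    x ∈ AddSubmonoid.closure
      {x | ∃ f ∈ Subring.center F, ∃ l ∈ Subring.center L, x = i f * j l} := by
  obtain ⟨e, he⟩ := exists_isSeparabilityElement hF
  obtain ⟨e', he'⟩ := exists_isSeparabilityElement hL
  -- The two separability elements fix central elements, and together they send any `i f * j l` to a
  -- product of images of central elements. So centrality of `x` can be dropped before the
  -- induction.
  have hx' : act i h.left e (act j h.right e' x) = x := by
    rw [he'.act_of_commute j h.right fun a => Subring.mem_center_iff.1 hx _,
      he.act_of_commute i h.left fun a => Subring.mem_center_iff.1 hx _]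
  rw [← hx']
  clear hx' hx
  induction h.mem_closure x using AddSubmonoid.closure_induction with
  | zero => rw [map_zero, map_zero]; exact zero_mem _
  | add x y _ _ hx hy => rw [map_add, map_add]; exact add_mem hx hy
  | mem x hx =>
    obtain ⟨f, l, rfl⟩ := hx
    refine AddSubmonoid.subset_closure ⟨_, he.1.act_mem_center f, _, he'.1.act_mem_center l, ?_⟩
    rw [act_mul_left j h.right e' (j l) fun a => (h.commute f a).symm,
      act_map (RingHom.id L) (isCentral_id L) j h.right j (fun _ => rfl) e' l,
      act_mul_right i h.left e (i f) fun a => h.commute a _,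
      act_map (RingHom.id F) (isCentral_id F) i h.left i (fun _ => rfl) e f]

end IsProduct

end Products

/-! ### Flat descent along possibly noncommutative algebras -/

section Descent

/-- A family of flat algebras which is jointly faithful. -/
structure IsFlatCover (C : Type*) [CommRing C] {ι : Type*} (L : ι → Type*) [∀ i, Ring (L i)]
    [∀ i, Algebra C (L i)] : Prop where
  flat : ∀ i, Module.Flat C (L i)
  exists_notMem : ∀ m : Ideal C, m.IsMaximal → ∃ i, (1 : L i) ∉ m • (⊤ : Submodule C (L i))

namespace IsFlatCover

variable {C : Type*} [CommRing C] {ι : Type*} {L : ι → Type*} [∀ i, Ring (L i)]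
  [∀ i, Algebra C (L i)] {N : Type*} [AddCommGroup N] [Module C N]

/-- If `x ≠ 0`, its annihilator `I` lies in a maximal ideal `m`. By flatness `C ⧸ I ≅ C x` stays
embedded after tensoring with `L i`, so `x ⊗ 1 = 0` puts `1` into `I • L i`, hence into `m • L i`.
-/
theorem eq_zero_of_tmul_one (h : IsFlatCover C L) (x : N)
    (hx : ∀ i, (x ⊗ₜ 1 : N ⊗[C] L i) = 0) : x = 0 := by
  by_contra hx0
  let I : Ideal C := LinearMap.ker (LinearMap.toSpanSingleton C N x)
  have hI : I ≠ ⊤ := fun hI => hx0 (by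
    have : (1 : C) ∈ I := hI ▸ Submodule.mem_top
    simpa [I] using this)
  obtain ⟨m, hm, hIm⟩ := Ideal.exists_le_maximal I hI
  obtain ⟨i, hi⟩ := h.exists_notMem m hm
  refine hi (Submodule.smul_mono_left hIm ?_)
  let ψ : (C ⧸ I) →ₗ[C] N := I.liftQ (LinearMap.toSpanSingleton C N x) le_rfl
  have hψ : Function.Injective ψ := LinearMap.ker_eq_bot.1 (Submodule.ker_liftQ_eq_bot _ _ _ le_rfl)
  have := h.flat i
  have hinj := Module.Flat.rTensor_preserves_injective_linearMap (M := L i) ψ hψ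
  have h0 : ((1 : C ⧸ I) ⊗ₜ[C] (1 : L i)) = 0 := hinj (by
    rw [LinearMap.rTensor_tmul, map_zero]
    have : ψ 1 = x := (one_smul C x)
    rw [this, hx])
  have := TensorProduct.quotTensorEquivQuotSMul_mk_one_tmul I (1 : L i)
  rw [h0, map_zero] at this
  exact (Submodule.Quotient.mk_eq_zero _).1 this.symm

theorem ext_of_tmul_one (h : IsFlatCover C L) (x y : N)
    (hx : ∀ i, (x ⊗ₜ 1 : N ⊗[C] L i) = y ⊗ₜ 1) : x = y :=
  sub_eq_zero.1 (h.eq_zero_of_tmul_one _ fun i => by rw [TensorProduct.sub_tmul, hx, sub_self])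

/-- Faithfully flat descent for elements of a module. -/
theorem exists_tmul_one [Finite ι] (h : IsFlatCover C L) (x : ∀ i, N ⊗[C] L i)
    (hx : ∀ i j, (x j ⊗ₜ 1 : (N ⊗[C] L j) ⊗[C] L i) =
      LinearMap.rTensor (L i) ((TensorProduct.mk C N (L j)).flip 1) (x i)) :
    ∃ n : N, ∀ i, n ⊗ₜ 1 = x i := by
  classical
  have := Fintype.ofFinite ι
  let f : N →ₗ[C] ∀ j, N ⊗[C] L j := LinearMap.pi fun j => (TensorProduct.mk C N (L j)).flip 1
  have hf : f = ∑ j, (LinearMap.single C (fun j => N ⊗[C] L j) j).comp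
      ((TensorProduct.mk C N (L j)).flip 1) := by
    ext n j
    simp [f, Finset.sum_apply]
  -- The compatibilities for all `j` say that `x` enters the image of `f` after tensoring with `L
  -- i`. Its class in the cokernel of `f` thus dies in every such tensor product, and is zero.
  have key : ∀ i, (x ⊗ₜ 1 : (∀ j, N ⊗[C] L j) ⊗[C] L i) = LinearMap.rTensor (L i) f (x i) := by
    intro i
    have hsum : x = ∑ j, LinearMap.single C (fun j => N ⊗[C] L j) j (x j) :=
      (Finset.univ_sum_single x).symm
    conv_lhs => rw [hsum]
    rw [TensorProduct.sum_tmul, hf]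
    have hr : ∀ (s : Finset ι) (g : ι → N →ₗ[C] ∀ j, N ⊗[C] L j),
        LinearMap.rTensor (L i) (∑ j ∈ s, g j) = ∑ j ∈ s, LinearMap.rTensor (L i) (g j) :=
      fun s g => map_sum (LinearMap.rTensorHom (L i)) g s
    rw [hr, LinearMap.sum_apply]
    refine Finset.sum_congr rfl fun j _ => ?_
    rw [LinearMap.rTensor_comp, LinearMap.comp_apply, ← hx i j, LinearMap.rTensor_tmul]
  have hq : (LinearMap.range f).mkQ x = 0 := by
    refine h.eq_zero_of_tmul_one _ fun i => ?_
    rw [← LinearMap.rTensor_tmul, key, ← LinearMap.comp_apply, ← LinearMap.rTensor_comp,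
      LinearMap.range_mkQ_comp, LinearMap.rTensor_zero, LinearMap.zero_apply]
  obtain ⟨n, hn⟩ := (Submodule.Quotient.mk_eq_zero _).1 hq
  exact ⟨n, fun i => congrFun hn i⟩

end IsFlatCover

/-- A flat family contains a finite family which is a flat cover. -/
theorem IsFlatFamily.exists_isFlatCover {s : SizeConvention} {E : Type*} [CommRing E] {ι : Type*}
    {D : ι → Type*} [∀ i, CommRing (D i)] [∀ i, Algebra E (D i)]
    (h : IsFlatFamily s fun i => algebraMap E (D i))
    (hs : s = .affine → IsNoetherianRing E ∧ ∀ i, Algebra.FiniteType E (D i)) :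
    ∃ κ : Set ι, κ.Finite ∧ IsFlatCover E fun i : κ => D i := by
  classical
  have hff : Module.FaithfullyFlat E (∀ i, D i) :=
    (RingHom.faithfullyFlat_algebraMap_iff (R := E) (S := ∀ i, D i)).1 h.2
  have hflat : ∀ i, Module.Flat E (D i) := fun i =>
    Module.Flat.of_retract (LinearMap.single E D i) (LinearMap.proj i) (by
      ext x; simp)
  have hmem : ∀ (m : Ideal E) (i : ι), (1 : D i) ∈ m • (⊤ : Submodule E (D i)) ↔
      m.map (algebraMap E (D i)) = ⊤ := fun m i => by
    rw [Ideal.smul_top_eq_map, Submodule.restrictScalars_mem, Ideal.eq_top_iff_one]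
  cases s with
  | all =>
    have hfin : Finite ι := h.1
    have := Fintype.ofFinite ι
    refine ⟨Set.univ, Set.toFinite _, fun i => hflat i, fun m hm => ?_⟩
    by_contra! hcon
    refine hff.submodule_ne_top hm ?_
    have h1 : (1 : ∀ i, D i) ∈ m • (⊤ : Submodule E (∀ i, D i)) := by
      have hsum : (1 : ∀ i, D i) = ∑ i, LinearMap.single E D i 1 :=
        (Finset.univ_sum_single (1 : ∀ i, D i)).symm
      rw [hsum]
      refine Submodule.sum_mem _ fun i _ => ?_
      have := Submodule.mem_map_of_mem (f := LinearMap.single E D i) (hcon ⟨i, trivial⟩)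
      rw [Submodule.map_smul''] at this
      exact Submodule.smul_mono le_rfl le_top this
    rw [Ideal.smul_top_eq_map, Submodule.restrictScalars_mem, ← Ideal.eq_top_iff_one] at h1
    rw [Ideal.smul_top_eq_map, h1]; rfl
  | affine =>
    obtain ⟨hE, hft⟩ := hs rfl
    -- Finitely many generators of `m` let the relations in the separate factors be assembled in an
    -- infinite product.
    have hex : ∀ m : Ideal E, m.IsMaximal → ∃ i, m.map (algebraMap E (D i)) ≠ ⊤ := by
      intro m hm
      by_contra! hcon
      obtain ⟨n, v, hv⟩ := Submodule.fg_iff_exists_fin_generating_family.1 (IsNoetherian.noetherian m)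
      have hc : ∀ i, ∃ c : Fin n → D i, ∑ k, c k * algebraMap E (D i) (v k) = 1 := fun i => by
        have := (Ideal.eq_top_iff_one _).1 (hcon i)
        rw [← hv, ← Ideal.span, Ideal.map_span, ← Set.range_comp] at this
        exact Ideal.mem_span_range_iff_exists_fun.1 this
      choose c hc using hc
      refine hff.submodule_ne_top hm ?_
      have h1 : (1 : ∀ i, D i) ∈ m.map (algebraMap E (∀ i, D i)) := by
        have : (1 : ∀ i, D i) = ∑ k, (fun i => c i k) * algebraMap E (∀ i, D i) (v k) := by
          ext i
          rw [Finset.sum_apply, Pi.one_apply, ← hc i]; rfl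
        rw [this]
        refine Ideal.sum_mem _ fun k _ => Ideal.mul_mem_left _ _ (Ideal.mem_map_of_mem _ ?_)
        rw [← hv]
        exact Submodule.subset_span ⟨k, rfl⟩
      rw [← Ideal.eq_top_iff_one] at h1
      rw [Ideal.smul_top_eq_map, h1]; rfl
    let U : ι → Set (PrimeSpectrum E) := fun i => Set.range (PrimeSpectrum.comap (algebraMap E (D i)))
    have hU : ∀ i, IsOpen (U i) := fun i => by
      have : Algebra.FinitePresentation E (D i) := Algebra.FinitePresentation.of_finiteType.1 (hft i)
      have := hflat i
      exact PrimeSpectrum.isOpenMap_comap_of_hasGoingDown_of_finitePresentation.isOpen_range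
    have hUm : ∀ (m : PrimeSpectrum E) i, m.asIdeal.IsMaximal →
        (m ∈ U i ↔ m.asIdeal.map (algebraMap E (D i)) ≠ ⊤) := by
      intro m i hm
      constructor
      · rintro ⟨q, rfl⟩ htop
        exact q.2.ne_top (top_le_iff.1 (htop ▸ Ideal.map_comap_le))
      · intro hne
        obtain ⟨q, hq, hle⟩ := Ideal.exists_le_maximal _ hne
        refine ⟨⟨q, hq.isPrime⟩, PrimeSpectrum.ext ?_⟩
        exact (hm.eq_of_le (Ideal.comap_ne_top _ hq.ne_top) (Ideal.map_le_iff_le_comap.1 hle)).symm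
    -- Flat maps of finite presentation have open image, and open sets are stable under
    -- generization; so the maximal ideals suffice. Quasi-compactness then gives the finite
    -- subfamily.
    have hcov : ∀ p : PrimeSpectrum E, ∃ i, p ∈ U i := by
      intro p
      obtain ⟨m, hm, hpm⟩ := Ideal.exists_le_maximal _ p.2.ne_top
      obtain ⟨i, hi⟩ := hex m hm
      refine ⟨i, ?_⟩
      have hmU : (⟨m, hm.isPrime⟩ : PrimeSpectrum E) ∈ U i := (hUm _ i hm).2 hi
      exact ((PrimeSpectrum.le_iff_specializes p ⟨m, hm.isPrime⟩).1 hpm).mem_open (hU i) hmU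
    obtain ⟨κ, hκ⟩ := isCompact_univ.elim_finite_subcover U hU
      fun p _ => Set.mem_iUnion.2 (hcov p)
    refine ⟨κ, κ.finite_toSet, fun i => hflat i, fun m hm => ?_⟩
    obtain ⟨i, hi, hmi⟩ := Set.mem_iUnion₂.1 (hκ (Set.mem_univ (⟨m, hm.isPrime⟩ : PrimeSpectrum E)))
    exact ⟨⟨i, hi⟩, fun h1 => (hUm _ i hm).1 hmi ((hmem m i).1 h1)⟩

end Descent

/-! ### Passing from the center to the Azumaya algebra -/

section Center

open Enveloping

variable {C D L : Type*} [CommRing C] [CommRing D] [Ring L] [Algebra C D] [Algebra C L]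
  (e : D ≃+* Subring.center L) (he : ∀ c, (e (algebraMap C D c) : L) = algebraMap C L c)

include he

/-- An Azumaya algebra is flat over a base over which its center is flat. -/
theorem flat_of_flat_center (hL : HasInvariantSystem L) [Module.Flat C D] : Module.Flat C L := by
  let _ : Algebra C (Subring.center L) := (e.toRingHom.comp (algebraMap C D)).toAlgebra
  have : IsScalarTower C (Subring.center L) L := IsScalarTower.of_algebraMap_eq fun c => (he c).symm
  have := isAzumaya_of_hasInvariantSystem hL
  let e' : D ≃ₐ[C] Subring.center L := AlgEquiv.ofRingEquiv (f := e) fun _ => rfl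
  have : Module.Flat C (Subring.center L) := Module.Flat.of_linearEquiv e'.symm.toLinearEquiv
  exact Module.Flat.trans C (Subring.center L) L

/-- A separability element acts as a `C`-linear retraction of `L` onto its center, sending `1` to
`1`. -/
theorem one_mem_smul_top_of_center (hL : HasInvariantSystem L) {m : Ideal C}
    (h : (1 : L) ∈ m • (⊤ : Submodule C L)) : (1 : D) ∈ m • (⊤ : Submodule C D) := by
  obtain ⟨t, ht, ht1⟩ := exists_isSeparabilityElement hL
  have hz : ∀ c, algebraMap C L c ∈ Subring.center L := fun c =>
    Subring.mem_center_iff.2 fun x => (Algebra.commutes c x).symm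
  let r : L →ₗ[C] D :=
    { toFun := fun x => e.symm ⟨_, ht.act_mem_center x⟩
      map_add' := fun x y => by
        rw [← map_add]; congr 1; exact Subtype.ext (map_add _ x y)
      map_smul' := fun c x => by
        have h1 : act (RingHom.id L) (isCentral_id L) t (c • x) =
            algebraMap C L c * act (RingHom.id L) (isCentral_id L) t x := by
          rw [Algebra.smul_def]
          exact act_mul_left (RingHom.id L) _ t x fun a => Subring.mem_center_iff.1 (hz c) a
        refine e.injective (Subtype.ext ?_)
        rw [RingHom.id_apply, Algebra.smul_def c (e.symm _), map_mul, RingEquiv.apply_symm_apply,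
          RingEquiv.apply_symm_apply, Subring.coe_mul, he]
        exact h1 }
  have hr : r 1 = 1 := by
    refine e.injective (Subtype.ext ?_)
    rw [map_one e]
    exact (congrArg Subtype.val (e.apply_symm_apply ⟨_, ht.act_mem_center 1⟩)).trans ht1
  have := Submodule.mem_map_of_mem (f := r) h
  rw [Submodule.map_smul'', hr] at this
  exact Submodule.smul_mono le_rfl le_top this

theorem finiteType_of_finiteType_center (hL : HasInvariantSystem L) (hD : Algebra.FiniteType C D) :
    Algebra.FiniteType C L := by
  let _ : Algebra C (Subring.center L) := (e.toRingHom.comp (algebraMap C D)).toAlgebra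
  have : IsScalarTower C (Subring.center L) L := IsScalarTower.of_algebraMap_eq fun c => (he c).symm
  have := isAzumaya_of_hasInvariantSystem hL
  let e' : D ≃ₐ[C] Subring.center L := AlgEquiv.ofRingEquiv (f := e) fun _ => rfl
  exact Algebra.FiniteType.trans (hD.equiv e') inferInstance

end Center

/-! ### Finite generation, needed for the convention `affine` -/

section FiniteType

/-- The center of an algebra as an algebra over the same base. -/
abbrev centerAlgebra (k E : Type*) [CommRing k] [Ring E] [Algebra k E] :
    Algebra k (Subring.center E) :=
  ((algebraMap k E).codRestrict (Subring.center E) fun c =>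
    Subring.mem_center_iff.2 fun x => (Algebra.commutes c x).symm).toAlgebra

/-- The Artin–Tate lemma for the center of an Azumaya algebra. -/
theorem finiteType_center {k E : Type*} [CommRing k] [IsNoetherianRing k] [Ring E] [Algebra k E]
    [Algebra k (Subring.center E)] [IsScalarTower k (Subring.center E) E]
    (h : IsAzumaya (Subring.center E) E) (hE : Algebra.FiniteType k E) :
    Algebra.FiniteType k (Subring.center E) := by
  -- `E` is already finite over a finitely generated subalgebra `B` of its center. As `B` is
  -- Noetherian, the center is finite over `B` too.
  obtain ⟨B, hB, hBE⟩ := exists_subalgebra_of_fg k (Subring.center E) E hE.1 h.toFinite.1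
  refine ⟨Algebra.fg_trans' (B.fg_top.2 hB) (Subalgebra.fg_of_submodule_fg ?_)⟩
  have : IsNoetherianRing B := isNoetherianRing_of_fg hB
  have : Module.Finite B E := ⟨hBE⟩
  exact fg_of_injective (IsScalarTower.toAlgHom B (Subring.center E) E).toLinearMap Subtype.val_injective

theorem finiteType_tensorProduct {k C F L : Type*} [CommRing k] [CommRing C] [Ring F] [Ring L]
    [Algebra k C] [Algebra k F] [Algebra k L] [Algebra C F] [Algebra C L] [IsScalarTower k C F]
    [IsScalarTower k C L] (hF : Algebra.FiniteType k F) (hL : Algebra.FiniteType k L) :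
    Algebra.FiniteType k (F ⊗[C] L) := by
  let i : F →ₐ[k] F ⊗[C] L := Algebra.TensorProduct.includeLeft
  let j : L →ₐ[k] F ⊗[C] L :=
    (Algebra.TensorProduct.includeRight : L →ₐ[C] F ⊗[C] L).restrictScalars k
  have : (⊤ : Subalgebra k F).map i ⊔ (⊤ : Subalgebra k L).map j = ⊤ := by
    refine top_le_iff.1 fun x _ => ?_
    induction x using TensorProduct.induction_on with
    | zero => exact zero_mem _
    | add x y hx hy => exact add_mem (hx trivial) (hy trivial)
    | tmul f l =>
      rw [show (f ⊗ₜ l : F ⊗[C] L) = i f * j l by simp [i, j]]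
      exact mul_mem ((le_sup_left : _ ≤ (⊤ : Subalgebra k F).map i ⊔ (⊤ : Subalgebra k L).map j)
        ⟨f, trivial, rfl⟩) ((le_sup_right : _ ≤ (⊤ : Subalgebra k F).map i ⊔ _) ⟨l, trivial, rfl⟩)
  exact ⟨this ▸ (hF.1.map i).sup (hL.1.map j)⟩

end FiniteType

/-! ### Sheaf conditions for generated topologies -/

section Sheaves

variable {𝒞 : Type*} [Category 𝒞] (P : 𝒞ᵒᵖ ⥤ Type*)

/-- The finest topology for which `P` is a sheaf consists of the sieves all of whose pullbacks
satisfy the sheaf condition. Hence the generating sieves need no stability of their own. -/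
theorem isSheaf_topologyOf {cov : ∀ X : 𝒞, Set (Sieve X)}
    (h : ∀ X, ∀ S ∈ cov X, ∀ (Y : 𝒞) (f : Y ⟶ X), Presieve.IsSheafFor P (S.pullback f).arrows) :
    Presieve.IsSheaf (topologyOf cov) P := by
  refine Presieve.isSheaf_of_le P (J₂ := Sheaf.finestTopologySingle P)
    (sInf_le fun X S hS => h X S hS) fun X S hS => ?_
  simpa using hS X (𝟙 X)

/-- A presheaf is a sheaf for a sieve when elements glue along some family of arrows in the sieve
and are determined by their restrictions to objects mapping to the family. -/
theorem isSheafFor_of_arrows {X : 𝒞} (T : Sieve X) {ι : Type*} (F : ι → 𝒞) (e : ∀ i, F i ⟶ X)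
    (he : ∀ i, T.arrows (e i))
    (hsep : ∀ (G : 𝒞) (g : G ⟶ X) (a b : P.obj (op G)),
      (∀ (H : 𝒞) (p : H ⟶ G) (i : ι) (q : H ⟶ F i), p ≫ g = q ≫ e i →
        P.map p.op a = P.map p.op b) → a = b)
    (hglue : ∀ x : ∀ i, P.obj (op (F i)), Presieve.Arrows.Compatible P e x →
      ∃ t, ∀ i, P.map (e i).op t = x i) :
    Presieve.IsSheafFor P T.arrows := by
  -- The sheaf condition passes from the subsieve generated by the family to `T` once sections over
  -- every arrow of `T` are determined by the pulled back subsieve. This is why `hsep` allows every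
  -- `G`.
  refine Presieve.isSheafFor_subsieve_aux P (S := Sieve.ofArrows F e) ?_ ?_ ?_
  · rintro Y f ⟨_, g, _, ⟨i⟩, rfl⟩
    exact T.downward_closed (he i) g
  · refine (Presieve.isSheafFor_iff_generate _).1 ((Presieve.isSheafFor_arrows_iff P e).2 ?_)
    intro x hx
    obtain ⟨t, ht⟩ := hglue x hx
    refine ⟨t, ht, fun t' ht' => hsep X (𝟙 X) t' t fun H p i q hpq => ?_⟩
    rw [Category.comp_id] at hpq
    subst hpq
    rw [op_comp, P.map_comp]
    change P.map q.op (P.map (e i).op t') = P.map q.op (P.map (e i).op t)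
    rw [ht, ht']
  · intro G g _ x t₁ t₂ h₁ h₂
    refine hsep G g t₁ t₂ fun H p i q hpq => ?_
    have hp : (Sieve.pullback g (Sieve.ofArrows F e)).arrows p :=
      ⟨_, q, _, Presieve.ofArrows.mk i, hpq.symm⟩
    rw [h₁ p hp, h₂ p hp]

end Sheaves

/-- An algebra map into an algebra embedded in a family of algebras may be defined pointwise. -/
theorem AlgHom.exists_comp_eq {k R F ι : Type*} {G : ι → Type*} [CommRing k] [Ring R] [Ring F]
    [∀ i, Ring (G i)] [Algebra k R] [Algebra k F] [∀ i, Algebra k (G i)] (u : ∀ i, F →ₐ[k] G i)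
    (hu : ∀ x y, (∀ i, u i x = u i y) → x = y) (ψ : ∀ i, R →ₐ[k] G i)
    (h : ∀ r, ∃ x, ∀ i, u i x = ψ i r) : ∃ φ : R →ₐ[k] F, ∀ i, (u i).comp φ = ψ i := by
  choose φ hφ using h
  exact ⟨{ toFun := φ
           map_one' := hu _ _ fun i => by rw [hφ, map_one, map_one]
           map_mul' := fun x y => hu _ _ fun i => by rw [hφ, map_mul, map_mul, hφ, hφ]
           map_zero' := hu _ _ fun i => by rw [hφ, map_zero, map_zero]
           map_add' := fun x y => hu _ _ fun i => by rw [hφ, map_add, map_add, hφ, hφ]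
           commutes' := fun c => hu _ _ fun i => by rw [hφ, AlgHom.commutes, AlgHom.commutes] },
    fun i => AlgHom.ext fun r => hφ r i⟩

/-! ### Descent in `A ⊗ Y` through a dual basis of `A` -/

section Coordinates

variable {k A : Type*} [CommRing k] [Ring A] [Algebra k A]

/-- The coordinate of an element of `A ⊗ Y` along a linear form on `A`. -/
def tensorCoord (φ : A →ₗ[k] k) (Y : Type*) [AddCommGroup Y] [Module k Y] : A ⊗[k] Y →ₗ[k] Y :=
  (TensorProduct.lid k Y).toLinearMap.comp (LinearMap.rTensor Y φ)

theorem tensorCoord_lTensor (φ : A →ₗ[k] k) {Y Y' : Type*} [AddCommGroup Y] [Module k Y]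
    [AddCommGroup Y'] [Module k Y'] (h : Y →ₗ[k] Y') (x : A ⊗[k] Y) :
    tensorCoord φ Y' (LinearMap.lTensor A h x) = h (tensorCoord φ Y x) := by
  induction x using TensorProduct.induction_on with
  | zero => simp
  | tmul a y => simp [tensorCoord]
  | add x y hx hy => simp only [map_add, hx, hy]

theorem exists_tensorCoord (k A : Type*) [CommRing k] [Ring A] [Algebra k A] [Module.Finite k A]
    [Module.Projective k A] : ∃ (n : ℕ) (y : Fin n → A) (φ : Fin n → A →ₗ[k] k),
      ∀ (Y : Type v) [AddCommGroup Y] [Module k Y] (x : A ⊗[k] Y),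
        ∑ i, y i ⊗ₜ tensorCoord (φ i) Y x = x := by
  obtain ⟨n, f, g, -, -, hfg⟩ := Module.Finite.exists_comp_eq_id_of_projective k A
  refine ⟨n, fun i => f (Pi.single i 1), fun i => (LinearMap.proj i).comp g, fun Y _ _ x => ?_⟩
  have hA : ∀ a, ∑ i, g a i • f (Pi.single i 1) = a := fun a => by
    have := LinearMap.congr_fun hfg a
    rw [LinearMap.comp_apply, LinearMap.id_apply] at this
    conv_rhs => rw [← this, ← Finset.univ_sum_single (g a), map_sum]
    refine Finset.sum_congr rfl fun i _ => ?_
    rw [← map_smul, ← Pi.single_smul, smul_eq_mul, mul_one]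
  induction x using TensorProduct.induction_on with
  | zero => simp
  | tmul a y =>
    conv_rhs => rw [← hA a]
    simp [tensorCoord, TensorProduct.sum_tmul, TensorProduct.smul_tmul]
  | add x y hx hy => simp only [map_add, TensorProduct.tmul_add, Finset.sum_add_distrib, hx, hy]

/-- Descent for elements of `A ⊗ Y`, where `A` is finite and projective. -/
theorem IsFlatCover.tensor_injective [Module.Finite k A] [Module.Projective k A] {E Y : Type*}
    [CommRing E] [CommRing Y] [Algebra k E] [Algebra k Y] [Algebra E Y] [IsScalarTower k E Y]
    {ι : Type*} {D : ι → Type*} [∀ i, CommRing (D i)] [∀ i, Algebra E (D i)]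
    (h : IsFlatCover E D) (x y : A ⊗[k] Y)
    (hxy : ∀ i, LinearMap.lTensor A (Algebra.TensorProduct.includeLeft :
      Y →ₐ[k] Y ⊗[E] D i).toLinearMap x = LinearMap.lTensor A (Algebra.TensorProduct.includeLeft :
      Y →ₐ[k] Y ⊗[E] D i).toLinearMap y) : x = y := by
  obtain ⟨n, z, φ, hφ⟩ := exists_tensorCoord k A
  rw [← hφ Y x, ← hφ Y y]
  refine Finset.sum_congr rfl fun l _ => ?_
  congr 1
  refine h.ext_of_tmul_one _ _ fun i => ?_
  have := congrArg (tensorCoord (φ l) _) (hxy i)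
  rwa [tensorCoord_lTensor, tensorCoord_lTensor] at this

theorem IsFlatCover.exists_tensor [Module.Finite k A] [Module.Projective k A] {E Y : Type*}
    [CommRing E] [CommRing Y] [Algebra k E] [Algebra k Y] [Algebra E Y] [IsScalarTower k E Y]
    {ι : Type*} [Finite ι] {D : ι → Type v} [∀ i, CommRing (D i)] [∀ i, Algebra E (D i)]
    (h : IsFlatCover E D) (x : ∀ i, A ⊗[k] (Y ⊗[E] D i))
    (hx : ∀ i j, LinearMap.lTensor A (Algebra.TensorProduct.includeLeft :
        Y ⊗[E] D j →ₐ[k] (Y ⊗[E] D j) ⊗[E] D i).toLinearMap (x j) =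
      LinearMap.lTensor A ((LinearMap.rTensor (D i)
        ((TensorProduct.mk E Y (D j)).flip 1)).restrictScalars k) (x i)) :
    ∃ y : A ⊗[k] Y, ∀ i, LinearMap.lTensor A (Algebra.TensorProduct.includeLeft :
      Y →ₐ[k] Y ⊗[E] D i).toLinearMap y = x i := by
  obtain ⟨n, z, φ, hφ⟩ := exists_tensorCoord k A
  have key : ∀ l, ∃ y : Y, ∀ i, y ⊗ₜ 1 = tensorCoord (φ l) _ (x i) := fun l =>
    h.exists_tmul_one (fun i => tensorCoord (φ l) _ (x i)) fun i j => by
      have := congrArg (tensorCoord (φ l) _) (hx i j)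
      rwa [tensorCoord_lTensor, tensorCoord_lTensor] at this
  choose y hy using key
  refine ⟨∑ l, z l ⊗ₜ y l, fun i => ?_⟩
  rw [map_sum]
  conv_rhs => rw [← hφ _ (x i)]
  refine Finset.sum_congr rfl fun l _ => ?_
  rw [LinearMap.lTensor_tmul, ← hy l i]; rfl

end Coordinates

/-! ### Pushouts of commutative algebras and the second statement -/

section CommSite

variable {s : SizeConvention} {k : Type u} [CommRing k]

/-- The pushout of two commutative algebras. -/
def CommSite.tensorObj (s : SizeConvention) (k : Type u) [CommRing k] (E Y D : Type u)
    [CommRing E] [CommRing Y] [CommRing D] [Algebra k E] [Algebra k Y] [Algebra k D]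
    [Algebra E Y] [Algebra E D] [IsScalarTower k E Y] [IsScalarTower k E D]
    (hY : s.Admits k Y) (hD : s.Admits k D) : CommSite.{u} s k :=
  ⟨CommAlgCat.of k (Y ⊗[E] D), by
    cases s with
    | all => trivial
    | affine => exact finiteType_tensorProduct (C := E) hY hD⟩

/-- A morphism of commutative algebras from an algebra map. -/
def CommSite.ofHom {X Y : CommSite.{u} s k} (f : X.obj →ₐ[k] Y.obj) : X ⟶ Y :=
  ObjectProperty.homMk (CommAlgCat.ofHom f)

theorem CommSite.hom_ext {X Y : CommSite.{u} s k} {f g : X ⟶ Y}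
    (h : ∀ x, f.hom.hom x = g.hom.hom x) : f = g :=
  ObjectProperty.hom_ext _ (CommAlgCat.hom_ext (AlgHom.ext h))

namespace CommSite

variable (X Y D : CommSite.{u} s k) [Algebra X.obj Y.obj] [IsScalarTower k X.obj Y.obj]
  [Algebra X.obj D.obj] [IsScalarTower k X.obj D.obj]

/-- The pushout of two objects under `X`. -/
abbrev pushout : CommSite.{u} s k :=
  tensorObj s k X.obj Y.obj D.obj Y.property D.property

/-- The first map into the pushout. -/
def inl : Y ⟶ pushout X Y D :=
  ofHom (Algebra.TensorProduct.includeLeft : Y.obj →ₐ[k] Y.obj ⊗[X.obj] D.obj)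

/-- The second map into the pushout. -/
def inr : D ⟶ pushout X Y D :=
  ofHom ((Algebra.TensorProduct.includeRight :
    D.obj →ₐ[X.obj] Y.obj ⊗[X.obj] D.obj).restrictScalars k)

instance algebraPushout : Algebra X.obj (pushout X Y D).obj :=
  inferInstanceAs (Algebra X.obj (Y.obj ⊗[X.obj] D.obj))

instance isScalarTowerPushout : IsScalarTower k X.obj (pushout X Y D).obj :=
  inferInstanceAs (IsScalarTower k X.obj (Y.obj ⊗[X.obj] D.obj))

variable {Y} in
/-- The functoriality of the pushout. -/
def pushoutMap {Y' : CommSite.{u} s k} [Algebra X.obj Y'.obj] [IsScalarTower k X.obj Y'.obj]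
    (g : Y.obj →ₐ[X.obj] Y'.obj) : pushout X Y D ⟶ pushout X Y' D :=
  ofHom ((Algebra.TensorProduct.map g (AlgHom.id X.obj D.obj) :
    Y.obj ⊗[X.obj] D.obj →ₐ[X.obj] Y'.obj ⊗[X.obj] D.obj).restrictScalars k)

end CommSite

end CommSite

namespace Azu

variable {s : SizeConvention}

theorem isNoetherianRing_center (A : Azu.{u} .affine) : IsNoetherianRing A.Z := by
  let _ : Algebra ℂ A.Z := centerAlgebra ℂ A
  have : IsScalarTower ℂ A.Z A := IsScalarTower.of_algebraMap_eq fun _ => rfl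
  have : Algebra.FiniteType ℂ A.Z := finiteType_center A.isAzumaya A.admits
  exact Algebra.FiniteType.isNoetherianRing ℂ A.Z

theorem isSheafFor_pullback_flatCovers (R : Type w) [Ring R] [Algebra ℂ R] (A : Azu.{u} s)
    (X : (CommSite.{u} s A.Z)ᵒᵖ) (S : Sieve X) (hS : S ∈ flatCovers s A.Z X)
    (Y : (CommSite.{u} s A.Z)ᵒᵖ) (h : Y ⟶ X) :
    Presieve.IsSheafFor (unopUnop (CommSite.{u} s A.Z) ⋙ Azu.tensorAlgFunctor R A)
      (S.pullback h).arrows := by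
  obtain ⟨ι, D, f, hf, hflat⟩ := hS
  have := A.isAzumaya
  let _ : ∀ i, Algebra X.unop.obj (D i).obj := fun i => (f i).hom.hom.toRingHom.toAlgebra
  have : ∀ i, IsScalarTower A.Z X.unop.obj (D i).obj := fun i =>
    IsScalarTower.of_algebraMap_eq fun c => ((f i).hom.hom.commutes c).symm
  obtain ⟨κ, hκ, hcov⟩ := IsFlatFamily.exists_isFlatCover (E := X.unop.obj)
    (D := fun i => (D i).obj) hflat (by
      rintro rfl
      have := A.isNoetherianRing_center
      have : Algebra.FiniteType A.Z X.unop.obj := X.unop.property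
      have : ∀ i, Algebra.FiniteType A.Z (D i).obj := fun i => (D i).property
      exact ⟨Algebra.FiniteType.isNoetherianRing A.Z _,
        fun i => Algebra.FiniteType.of_restrictScalars_finiteType A.Z _ _⟩)
  have := hκ.to_subtype
  let _ : Algebra X.unop.obj Y.unop.obj := h.unop.hom.hom.toRingHom.toAlgebra
  have : IsScalarTower A.Z X.unop.obj Y.unop.obj :=
    IsScalarTower.of_algebraMap_eq fun c => (h.unop.hom.hom.commutes c).symm
  refine isSheafFor_of_arrows _ _ (ι := κ)
    (fun i => op (CommSite.pushout X.unop Y.unop (D i)))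
    (fun i => (CommSite.inl X.unop Y.unop (D i)).op) (fun i => ?_) ?_ ?_
  · have : (CommSite.inl X.unop Y.unop (D i)).op ≫ h =
        (CommSite.inr X.unop Y.unop (D i)).op ≫ (f i).op := by
      refine Quiver.Hom.unop_inj (CommSite.hom_ext fun x => ?_)
      exact ((Algebra.TensorProduct.includeRight :
        (D i).obj →ₐ[X.unop.obj] Y.unop.obj ⊗[X.unop.obj] (D i).obj).commutes x).symm
    rw [Sieve.pullback_apply, this]
    exact S.downward_closed (hf i) _
  · intro G g a b hab
    let _ : Algebra X.unop.obj G.unop.obj := (h.unop ≫ g.unop).hom.hom.toRingHom.toAlgebra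
    have : IsScalarTower A.Z X.unop.obj G.unop.obj :=
      IsScalarTower.of_algebraMap_eq fun c => ((h.unop ≫ g.unop).hom.hom.commutes c).symm
    let g' : Y.unop.obj →ₐ[X.unop.obj] G.unop.obj :=
      { g.unop.hom.hom.toRingHom with commutes' := fun _ => rfl }
    let a' : R →ₐ[ℂ] A ⊗[A.Z] G.unop.obj := a
    let b' : R →ₐ[ℂ] A ⊗[A.Z] G.unop.obj := b
    change a' = b'
    refine AlgHom.ext fun r => hcov.tensor_injective (a' r) (b' r) fun i => ?_
    have := hab (op (CommSite.pushout X.unop G.unop (D i)))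
      (CommSite.inl X.unop G.unop (D i)).op i (CommSite.pushoutMap X.unop (D i) g').op (by
        refine Quiver.Hom.unop_inj (CommSite.hom_ext fun x => ?_)
        rfl)
    exact congrArg (fun φ : R →ₐ[ℂ] A ⊗[A.Z] (CommSite.pushout X.unop G.unop (D i)).obj => φ r) this
  · intro x hx
    let x' : ∀ i : κ, R →ₐ[ℂ] A ⊗[A.Z] (CommSite.pushout X.unop Y.unop (D i)).obj := x
    have key := AlgHom.exists_comp_eq (k := ℂ) (R := R) (F := A ⊗[A.Z] Y.unop.obj)
      (G := fun i : κ => A ⊗[A.Z] (CommSite.pushout X.unop Y.unop (D i)).obj)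
      (fun i => A.baseChangeMap (CommSite.inl X.unop Y.unop (D i)).hom)
      (fun a b hab => hcov.tensor_injective _ _ hab) x' (fun r => by
        refine hcov.exists_tensor (fun i => x' i r) fun i j => ?_
        let l : Y.unop.obj →ₐ[X.unop.obj] (CommSite.pushout X.unop Y.unop (D j)).obj :=
          (Algebra.TensorProduct.includeLeft :
            Y.unop.obj →ₐ[X.unop.obj] Y.unop.obj ⊗[X.unop.obj] (D j).obj)
        -- Compatibility is tested on `(Y ⊗ D j) ⊗ D i`, the overlap in the shape used by
        -- `exists_tensor`.
        have := hx j i (op (CommSite.pushout X.unop (CommSite.pushout X.unop Y.unop (D j)) (D i)))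
          (CommSite.inl _ _ _).op (CommSite.pushoutMap X.unop (D i) l).op (by
            refine Quiver.Hom.unop_inj (CommSite.hom_ext fun x => ?_)
            rfl)
        exact congrArg (fun φ : R →ₐ[ℂ] A ⊗[A.Z] (CommSite.pushout X.unop
          (CommSite.pushout X.unop Y.unop (D j)) (D i)).obj => φ r) this)
    obtain ⟨φ, hφ⟩ := key
    exact ⟨φ, hφ⟩

end Azu

/-! ### Maps out of an algebra generated by `A` and its centralizer -/

section CentralizerMaps

open Enveloping

variable {A B L E : Type*} [Ring A] [Ring B] [Ring L] [Ring E] {g : A →+* B} {j : L →+* B}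

theorem IsCentralizer.mem_closure (h : IsCentralizer g j) (hg : IsCentral g)
    (hA : HasInvariantSystem A) (b : B) :
    b ∈ AddSubmonoid.closure {x | ∃ a l, x = g a * j l} := by
  obtain ⟨n, y, t, ht, hyt⟩ := hA
  rw [← sum_mul_act g hg hyt b]
  exact sum_mem fun k _ => AddSubmonoid.subset_closure
    ⟨y k, h.proj hg (ht k) b, by rw [h.map_proj]⟩

/-- Commuting ring maps out of an Azumaya algebra `A` and its centralizer in `B` which agree on the
center of `A` extend to `B`. -/
theorem IsCentralizer.exists_ringHom (h : IsCentralizer g j) (hg : IsCentral g)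
    (hA : HasInvariantSystem A) (α : A →+* E) (β : L →+* E)
    (hc : ∀ a l, α a * β l = β l * α a)
    (hz : ∀ z ∈ Subring.center A, ∀ l, j l = g z → β l = α z) :
    ∃ q : B →+* E, (∀ a, q (g a) = α a) ∧ ∀ l, q (j l) = β l := by
  have hcl := h.mem_closure hg hA
  obtain ⟨n, y, t, ht, hyt⟩ := hA
  -- The formula is forced by the expansion of `b` along the invariant system of `A`.
  let q : B →+ E := ∑ k, (AddMonoidHom.mulLeft (α (y k))).comp
    (β.toAddMonoidHom.comp (h.proj hg (ht k)))
  have hq : ∀ a l, q (g a * j l) = α a * β l := by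
    intro a l
    have h1 : ∀ k, β (h.proj hg (ht k) (g a * j l)) =
        α (act (RingHom.id A) (isCentral_id A) (t k) a) * β l := by
      intro k
      rw [h.proj_mul_right, map_mul]
      congr 1
      refine hz _ ((ht k).act_mem_center a) _ ?_
      rw [h.map_proj, act_map (RingHom.id A) (isCentral_id A) g hg g (fun _ => rfl)]
    have h2 : q (g a * j l) = ∑ k, α (y k) * β (h.proj hg (ht k) (g a * j l)) := by
      rw [AddMonoidHom.finsetSum_apply]; rfl
    rw [h2]
    simp only [h1, ← mul_assoc, ← map_mul]
    rw [← Finset.sum_mul, ← map_sum]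
    congr 2
    exact sum_mul_act (RingHom.id A) (isCentral_id A) hyt a
  have hmul : ∀ b b', q (b * b') = q b * q b' := by
    intro b b'
    induction hcl b using AddSubmonoid.closure_induction with
    | zero => simp
    | add x y _ _ hx hy => rw [add_mul, map_add, hx, hy, map_add, add_mul]
    | mem x hx =>
      obtain ⟨a, l, rfl⟩ := hx
      induction hcl b' using AddSubmonoid.closure_induction with
      | zero => simp
      | add x y _ _ hx hy => rw [mul_add, map_add, hx, hy, map_add, mul_add]
      | mem x hx =>
        obtain ⟨a', l', rfl⟩ := hx
        have h1 : g a * j l * (g a' * j l') = g (a * a') * j (l * l') := by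
          rw [map_mul, map_mul, mul_assoc, ← mul_assoc (j l), ← h.commute]
          simp only [mul_assoc]
        rw [h1, hq, hq, hq, map_mul, map_mul, mul_assoc (α a) (β l), ← mul_assoc (β l), ← hc]
        simp only [mul_assoc]
  have hg' : ∀ a, q (g a) = α a := fun a => by
    have := hq a 1
    rwa [map_one, map_one, mul_one, mul_one] at this
  refine ⟨{ q with
    map_one' := by
      change q 1 = 1
      rw [← map_one g, hg', map_one]
    map_mul' := hmul }, hg', fun l => ?_⟩
  change q (j l) = β l
  have := hq 1 l
  rwa [map_one, map_one, one_mul, one_mul] at this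

end CentralizerMaps

theorem isProduct_includeLeft_includeRight (C F L : Type*) [CommRing C] [Ring F] [Ring L]
    [Algebra C F] [Algebra C L] :
    IsProduct (Algebra.TensorProduct.includeLeft : F →ₐ[C] F ⊗[C] L).toRingHom
      (Algebra.TensorProduct.includeRight : L →ₐ[C] F ⊗[C] L).toRingHom where
  left z hz := Subring.mem_center_iff.2 fun x => by
    change x * (z ⊗ₜ 1) = (z ⊗ₜ 1) * x
    induction x using TensorProduct.induction_on with
    | zero => simp
    | tmul f l => simp [Subring.mem_center_iff.1 hz f]
    | add x y hx hy => rw [add_mul, mul_add, hx, hy]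
  right z hz := Subring.mem_center_iff.2 fun x => by
    change x * (1 ⊗ₜ z) = (1 ⊗ₜ z) * x
    induction x using TensorProduct.induction_on with
    | zero => simp
    | tmul f l => simp [Subring.mem_center_iff.1 hz l]
    | add x y hx hy => rw [add_mul, mul_add, hx, hy]
  commute f l := by
    change (f ⊗ₜ 1 : F ⊗[C] L) * (1 ⊗ₜ l) = (1 ⊗ₜ l) * (f ⊗ₜ 1)
    simp
  mem_closure x := by
    induction x using TensorProduct.induction_on with
    | zero => exact zero_mem _
    | tmul f l =>
      refine AddSubmonoid.subset_closure ⟨f, l, ?_⟩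
      change (f ⊗ₜ l : F ⊗[C] L) = (f ⊗ₜ 1) * (1 ⊗ₜ l)
      simp
    | add x y hx hy => exact add_mem hx hy

/-- The center of `F ⊗ L` is generated by the images of the two centers, and on each of these the
claim is clear. -/
theorem map_mem_center_tensorProduct {C F F' L : Type*} [CommRing C] [Ring F] [Ring F'] [Ring L]
    [Algebra C F] [Algebra C F'] [Algebra C L] (hF : HasInvariantSystem F)
    (hL : HasInvariantSystem L) (u : F →ₐ[C] F') (hu : Enveloping.IsCentral u.toRingHom)
    {z : F ⊗[C] L} (hz : z ∈ Subring.center (F ⊗[C] L)) :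
    Algebra.TensorProduct.map u (AlgHom.id C L) z ∈ Subring.center (F' ⊗[C] L) := by
  have hp' := isProduct_includeLeft_includeRight C F' L
  have hcl := (isProduct_includeLeft_includeRight C F L).mem_closure_of_mem_center hF hL hz
  clear hz
  induction hcl using AddSubmonoid.closure_induction with
  | zero => rw [map_zero]; exact zero_mem _
  | add x y _ _ hx hy => rw [map_add]; exact add_mem hx hy
  | mem x hx =>
    obtain ⟨f, hf, l, hl, rfl⟩ := hx
    rw [map_mul]
    refine mul_mem ?_ ?_
    · refine Eq.mp (congrArg (· ∈ Subring.center (F' ⊗[C] L)) ?_) (hp'.left _ (hu f hf))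
      change u f ⊗ₜ 1 = Algebra.TensorProduct.map u (AlgHom.id C L) (f ⊗ₜ 1)
      simp
    · refine Eq.mp (congrArg (· ∈ Subring.center (F' ⊗[C] L)) ?_) (hp'.right _ hl)
      change 1 ⊗ₜ l = Algebra.TensorProduct.map u (AlgHom.id C L) (1 ⊗ₜ l)
      simp

/-! ### Amalgamation in `Azu` and the first statement -/

namespace Azu

variable {s : SizeConvention} {A B : Azu.{u} s}

theorem hasInvariantSystem (A : Azu.{u} s) : HasInvariantSystem A :=
  hasInvariantSystem_of_isAzumaya A A.isAzumaya

theorem Hom.isCentral (g : A ⟶ B) : Enveloping.IsCentral g.toAlgHom.toRingHom := g.map_center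

instance algebraCenter (A : Azu.{u} s) : Algebra ℂ A.Z := centerAlgebra ℂ A

instance isScalarTowerCenter (A : Azu.{u} s) : IsScalarTower ℂ A.Z A :=
  IsScalarTower.of_algebraMap_eq fun _ => rfl

/-- The centralizer of the image of a morphism of Azumaya algebras. -/
def Cent (g : A ⟶ B) : Type u := Subalgebra.centralizer ℂ (Set.range g.toAlgHom)

namespace Cent

variable (g : A ⟶ B)

instance : Ring (Cent g) := inferInstanceAs (Ring (Subalgebra.centralizer ℂ _))
instance : Algebra ℂ (Cent g) := inferInstanceAs (Algebra ℂ (Subalgebra.centralizer ℂ _))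

/-- The inclusion of the centralizer. -/
def val : Cent g →ₐ[ℂ] B := (Subalgebra.centralizer ℂ (Set.range g.toAlgHom)).val

theorem isCentralizer : IsCentralizer g.toAlgHom.toRingHom (val g).toRingHom where
  injective := Subtype.val_injective
  commute a l := (Subalgebra.mem_centralizer_iff ℂ).1 l.2 _ ⟨a, rfl⟩
  exists_eq b hb := ⟨⟨b, (Subalgebra.mem_centralizer_iff ℂ).2 (by rintro _ ⟨a, rfl⟩; exact hb a)⟩,
    rfl⟩

theorem hasInvariantSystem : HasInvariantSystem (Cent g) :=
  (isCentralizer g).hasInvariantSystem (Hom.isCentral g) A.hasInvariantSystem B.hasInvariantSystem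

instance : Algebra A.Z (Cent g) :=
  RingHom.toAlgebra' ((g.toAlgHom.toRingHom.comp A.Z.subtype).codRestrict
      (Subalgebra.centralizer ℂ (Set.range g.toAlgHom)) fun z =>
      (Subalgebra.mem_centralizer_iff ℂ).2 fun _ _ =>
        Subring.mem_center_iff.1 (g.map_center z z.2) _)
    fun z _ => Subtype.ext (Subring.mem_center_iff.1 (g.map_center z z.2) _).symm

instance : IsScalarTower ℂ A.Z (Cent g) := IsScalarTower.of_algebraMap_eq fun c =>
  Subtype.ext (g.toAlgHom.commutes c).symm

/-- The center of the centralizer. -/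
def centerEquiv : B.Z ≃+* Subring.center (Cent g) :=
  RingEquiv.symm <| RingEquiv.ofBijective
    ((((val g).toRingHom.comp (Subring.center (Cent g)).subtype).codRestrict B.Z) fun z =>
      (isCentralizer g).isCentral (Hom.isCentral g) A.hasInvariantSystem z z.2)
    ⟨fun x y hxy => Subtype.ext ((isCentralizer g).injective
      (congrArg (fun z : B.Z => (z : B)) hxy)),
      fun z => by
        obtain ⟨l, hl, hlz⟩ := (isCentralizer g).exists_center z.2
        exact ⟨⟨l, hl⟩, Subtype.ext hlz⟩⟩

theorem val_centerEquiv (z : B.Z) : val g (centerEquiv g z) = z :=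
  congrArg Subtype.val ((centerEquiv g).symm_apply_apply z)

theorem finiteType {A B : Azu.{u} .affine} (g : A ⟶ B) : Algebra.FiniteType ℂ (Cent g) :=
  finiteType_of_finiteType_center (centerEquiv g)
    (fun c => (isCentralizer g).injective (by
      refine (val_centerEquiv g _).trans ?_
      exact ((val g).commutes c).symm))
    (hasInvariantSystem g) (finiteType_center B.isAzumaya B.admits)

end Cent

section Pushout

variable (F : Azu.{u} s) [Algebra A.Z F] [IsScalarTower ℂ A.Z F] (g : A ⟶ B)

/-- The amalgamation of `F` and `B` over `A`. -/
def pushout : Azu.{u} s where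
  carrier := F ⊗[A.Z] Cent g
  isAzumaya := isAzumaya_of_hasInvariantSystem
    ((isProduct_includeLeft_includeRight A.Z F (Cent g)).hasInvariantSystem F.hasInvariantSystem
      (Cent.hasInvariantSystem g))
  admits := by
    cases s with
    | all => trivial
    | affine => exact finiteType_tensorProduct F.admits (Cent.finiteType g)

/-- The first map into the amalgamation. -/
def inl : F ⟶ pushout F g where
  toAlgHom := (Algebra.TensorProduct.includeLeft : F →ₐ[ℂ] F ⊗[A.Z] Cent g)
  map_center := (isProduct_includeLeft_includeRight A.Z F (Cent g)).left

/-- In `F ⊗ Cent g` the images of `A`, through `F`, and of `Cent g` commute and agree on `Z(A)`, so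
they extend to `B`. Centers are preserved because the center of `B` comes from that of `Cent g`. -/
theorem exists_inr (h : A ⟶ F) (hh : ∀ z : A.Z, algebraMap A.Z F z = h.toAlgHom z) :
    ∃ q : B ⟶ pushout F g, g ≫ q = h ≫ inl F g := by
  have hp := isProduct_includeLeft_includeRight A.Z F (Cent g)
  obtain ⟨q, hq, hq'⟩ := (Cent.isCentralizer g).exists_ringHom (Hom.isCentral g)
    A.hasInvariantSystem ((Algebra.TensorProduct.includeLeft :
      F →ₐ[A.Z] F ⊗[A.Z] Cent g).toRingHom.comp h.toAlgHom.toRingHom)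
    (Algebra.TensorProduct.includeRight : Cent g →ₐ[A.Z] F ⊗[A.Z] Cent g).toRingHom
    (fun a l => hp.commute _ l) (fun z hz l hl => by
      have : l = algebraMap A.Z (Cent g) ⟨z, hz⟩ := (Cent.isCentralizer g).injective hl
      rw [this]
      refine ((Algebra.TensorProduct.includeRight : Cent g →ₐ[A.Z] F ⊗[A.Z] Cent g).commutes
        ⟨z, hz⟩).trans ?_
      exact congrArg (fun f : F => (f ⊗ₜ 1 : F ⊗[A.Z] Cent g)) (hh ⟨z, hz⟩))
  let q' : B →ₐ[ℂ] F ⊗[A.Z] Cent g :=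
    { q with
      commutes' := fun c => by
        change q (algebraMap ℂ B c) = _
        rw [← g.toAlgHom.commutes c]
        refine (hq _).trans ?_
        exact congrArg (fun f : F => (f ⊗ₜ 1 : F ⊗[A.Z] Cent g)) (h.toAlgHom.commutes c) }
  refine ⟨⟨q', fun z hz => ?_⟩, Hom.ext (AlgHom.ext hq)⟩
  obtain ⟨l, hl, rfl⟩ := (Cent.isCentralizer g).exists_center hz
  exact (hq' l).symm ▸ hp.right l hl

variable {F} {F' : Azu.{u} s} [Algebra A.Z F'] [IsScalarTower ℂ A.Z F']

/-- A morphism under the center of `A` as an algebra map over this center. -/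
def algHomOver (u : F ⟶ F') (hu : ∀ z : A.Z, u.toAlgHom (algebraMap A.Z F z) = algebraMap A.Z F' z) :
    F →ₐ[A.Z] F' :=
  { u.toAlgHom.toRingHom with commutes' := hu }

/-- The functoriality of the amalgamation. -/
def pushoutMap (u : F ⟶ F') (hu : ∀ z : A.Z, u.toAlgHom (algebraMap A.Z F z) = algebraMap A.Z F' z) :
    pushout F g ⟶ pushout F' g where
  toAlgHom := (Algebra.TensorProduct.map (algHomOver u hu) (AlgHom.id A.Z (Cent g))).restrictScalars ℂ
  map_center _ hz := map_mem_center_tensorProduct F.hasInvariantSystem (Cent.hasInvariantSystem g)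
    (algHomOver u hu) (Hom.isCentral u) hz

end Pushout

theorem isSheafFor_pullback_flatExtensionCovers (R : Type w) [Ring R] [Algebra ℂ R]
    (K : GrothendieckTopology DivPos) (hK : K ≤ DivPos.maximalTopology) (X : (Azu.{u} s)ᵒᵖ)
    (S : Sieve X) (hS : S ∈ flatExtensionCovers s K X) (Y : (Azu.{u} s)ᵒᵖ) (h : Y ⟶ X) :
    Presieve.IsSheafFor (unopUnop (Azu.{u} s) ⋙ Azu.algFunctor s R) (S.pullback h).arrows := by
  obtain ⟨ι, D, hD, hflat⟩ := hS
  -- Only nonemptiness of the sieve of represented degrees matters, so the argument covers every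
  -- topology below the maximal one.
  have hrep : ∀ i, ∃ m, IsRepresented (A := X.unop) S (D i).obj m := fun i => by
    obtain ⟨n, -, hn⟩ := hD i
    obtain ⟨m, -, m', -, -, hm', -⟩ := hK _ hn
    exact ⟨_, hm'⟩
  choose m B φ g _ hinj hrange hφ hgS using hrep
  obtain ⟨κ, hκ, hcovD⟩ := IsFlatFamily.exists_isFlatCover (E := X.unop.Z)
    (D := fun i => (D i).obj) hflat (by
      rintro rfl
      exact ⟨X.unop.isNoetherianRing_center, fun i => (D i).property⟩)
  have := hκ.to_subtype
  -- Both `D i` and the center of `Cent (g i)` are identified with the center of `B i`, compatibly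
  -- with `Z(A)`.
  have hcov : IsFlatCover X.unop.Z fun i : κ => Cent (g i) := by
    let e₀ : ∀ i, (D i).obj ≃+* (B i).Z := fun i => RingEquiv.ofBijective
      (((φ i).toRingHom.comp (Algebra.TensorProduct.includeRight :
        (D i).obj →ₐ[X.unop.Z] X.unop ⊗[X.unop.Z] (D i).obj).toRingHom).codRestrict (B i).Z
          fun d => (hrange i).subset ⟨d, rfl⟩)
      ⟨fun x y hxy => hinj i (congrArg Subtype.val hxy), fun z => by
        obtain ⟨d, hd⟩ := (hrange i).superset z.2
        exact ⟨d, Subtype.ext hd⟩⟩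
    have he : ∀ i (c : X.unop.Z), ((e₀ i).trans (Cent.centerEquiv (g i)) (algebraMap _ _ c) :
        Cent (g i)) = algebraMap _ _ c := fun i c => (Cent.isCentralizer (g i)).injective (by
      refine (Cent.val_centerEquiv (g i) _).trans ?_
      change φ i (1 ⊗ₜ algebraMap _ _ c) = (g i).toAlgHom c
      rw [hφ]
      congr 1
      exact (Algebra.TensorProduct.includeRight :
        (D i).obj →ₐ[X.unop.Z] X.unop ⊗[X.unop.Z] (D i).obj).commutes c)
    refine ⟨fun i => ?_, fun m hm => ?_⟩
    · have := hcovD.flat i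
      exact flat_of_flat_center _ (he i) (Cent.hasInvariantSystem _)
    · obtain ⟨i, hi⟩ := hcovD.exists_notMem m hm
      exact ⟨i, fun h1 => hi (one_mem_smul_top_of_center _ (he i) (Cent.hasInvariantSystem _) h1)⟩
  have hcenter : ∀ {F : Azu.{u} s} (f : X.unop ⟶ F), ∀ c : X.unop.Z, ∀ x : F,
      f.toAlgHom c * x = x * f.toAlgHom c := fun f c x =>
    (Subring.mem_center_iff.1 (f.map_center c c.2) x).symm
  let _ : Algebra X.unop.Z Y.unop :=
    (h.unop.toAlgHom.toRingHom.comp X.unop.Z.subtype).toAlgebra' (hcenter h.unop)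
  have : IsScalarTower ℂ X.unop.Z Y.unop :=
    IsScalarTower.of_algebraMap_eq fun c => (h.unop.toAlgHom.commutes c).symm
  refine isSheafFor_of_arrows _ _ (ι := κ) (fun i => op (pushout Y.unop (g i)))
    (fun i => (inl Y.unop (g i)).op) (fun i => ?_) ?_ ?_
  -- The composite of `h` with the map into the amalgam factors through `g i`, which is in `S`.
  · obtain ⟨q, hq⟩ := exists_inr Y.unop (g i) h.unop fun _ => rfl
    have : (inl Y.unop (g i)).op ≫ h = q.op ≫ (g i).op := Quiver.Hom.unop_inj hq.symm
    rw [Sieve.pullback_apply, this]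
    exact S.downward_closed (hgS i) _
  · intro G f a b hab
    let _ : Algebra X.unop.Z G.unop :=
      ((h.unop ≫ f.unop).toAlgHom.toRingHom.comp X.unop.Z.subtype).toAlgebra'
        (hcenter (h.unop ≫ f.unop))
    have : IsScalarTower ℂ X.unop.Z G.unop :=
      IsScalarTower.of_algebraMap_eq fun c => ((h.unop ≫ f.unop).toAlgHom.commutes c).symm
    let a' : R →ₐ[ℂ] G.unop := a
    let b' : R →ₐ[ℂ] G.unop := b
    change a' = b'
    refine AlgHom.ext fun r => hcov.ext_of_tmul_one (a' r) (b' r) fun i => ?_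
    have := hab (op (pushout G.unop (g i))) (inl G.unop (g i)).op i
      (pushoutMap (g i) f.unop fun _ => rfl).op (by
        refine Quiver.Hom.unop_inj (Hom.ext (AlgHom.ext fun x => ?_))
        rfl)
    exact congrArg (fun φ : R →ₐ[ℂ] pushout G.unop (g i) => φ r) this
  · intro x hx
    let x' : ∀ i : κ, R →ₐ[ℂ] pushout Y.unop (g i) := x
    obtain ⟨ψ, hψ⟩ := AlgHom.exists_comp_eq (k := ℂ) (R := R) (F := Y.unop)
      (G := fun i : κ => pushout Y.unop (g i)) (fun i => (inl Y.unop (g i)).toAlgHom)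
      (fun a b hab => hcov.ext_of_tmul_one a b hab) x' (fun r => by
        refine hcov.exists_tmul_one (fun i => x' i r) fun i j => ?_
        let _ : Algebra X.unop.Z (pushout Y.unop (g j)) :=
          inferInstanceAs (Algebra X.unop.Z (Y.unop ⊗[X.unop.Z] Cent (g j)))
        have : IsScalarTower ℂ X.unop.Z (pushout Y.unop (g j)) :=
          inferInstanceAs (IsScalarTower ℂ X.unop.Z (Y.unop ⊗[X.unop.Z] Cent (g j)))
        -- The iterated amalgam replaces a fibre product: its underlying module is the one in the
        -- descent condition, and both maps into it preserve centers.
        have := hx j i (op (pushout (pushout Y.unop (g j)) (g i))) (inl _ _).op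
          (pushoutMap (g i) (inl Y.unop (g j)) fun _ => rfl).op (by
            refine Quiver.Hom.unop_inj (Hom.ext (AlgHom.ext fun x => ?_))
            rfl)
        exact congrArg (fun φ : R →ₐ[ℂ] pushout (pushout Y.unop (g j)) (g i) => φ r) this)
    exact ⟨ψ, hψ⟩

end Azu

end

theorem mainTheorem2 (s : SizeConvention) (R : Type w) [Ring R] [Algebra ℂ R] :
    (Presieve.IsSheaf (Azu.maximalFlatTopology.{u} s)
        (unopUnop (Azu.{u} s) ⋙ Azu.algFunctor s R) ∧
      ∀ J : GrothendieckTopology (Azu.{u} s)ᵒᵖ, J ≤ Azu.maximalFlatTopology s →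
        Presieve.IsSheaf J (unopUnop (Azu.{u} s) ⋙ Azu.algFunctor s R)) ∧
    ∀ A : Azu.{u} s,
      Presieve.IsSheaf (flatTopology.{u} s A.Z)
        (unopUnop (CommSite.{u} s A.Z) ⋙ Azu.tensorAlgFunctor R A) ∧
      ∀ J : GrothendieckTopology (CommSite.{u} s A.Z)ᵒᵖ, J ≤ flatTopology s A.Z →
        Presieve.IsSheaf J (unopUnop (CommSite.{u} s A.Z) ⋙ Azu.tensorAlgFunctor R A) := by
  have h₁ : Presieve.IsSheaf (Azu.maximalFlatTopology.{u} s)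
      (unopUnop (Azu.{u} s) ⋙ Azu.algFunctor s R) :=
    isSheaf_topologyOf _ (Azu.isSheafFor_pullback_flatExtensionCovers R _ le_rfl)
  have h₂ : ∀ A : Azu.{u} s, Presieve.IsSheaf (flatTopology.{u} s A.Z)
      (unopUnop (CommSite.{u} s A.Z) ⋙ Azu.tensorAlgFunctor R A) := fun A =>
    isSheaf_topologyOf _ (Azu.isSheafFor_pullback_flatCovers R A)
  exact ⟨⟨h₁, fun J hJ => Presieve.isSheaf_of_le _ hJ h₁⟩,
    fun A => ⟨h₂ A, fun J hJ => Presieve.isSheaf_of_le _ hJ (h₂ A)⟩⟩
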